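/- Let $k$ be a field of characteristic $0$ and $A$ any associative unital $k$-algebra. Let $\Omega^\bullet A=T_A(\Omega^1A)$, $\Omega^1A=\ker(A\otimes A\to A)$, be the algebra of noncommutative differential forms, with the de Rham differential $d(a_0\,da_1\cdots da_n)=da_0\,da_1\cdots da_n$. Let $\Delta:A\to A\otimes A$ be the double derivation $\Delta(a)=1\otimes a-a\otimes 1$, put $i_\Delta(u\,dv)=u\,\Delta(v)=\sum i'_\Delta(u\,dv)\otimes i''_\Delta(u\,dv)$ on $1$-forms, and let $\imath_\Delta:\Omega^\bullet A\to\Omega^{\bullet-1}A$ be the reduced contraction, which vanishes on $\Omega^0A$ and satisfies $$\imath_\Delta(\alpha_1\cdots\alpha_n)=\sum_{j=1}^n(-1)^{(j-1)(n-j+1)}\,(i''_\Delta\alpha_j)\,\alpha_{j+1}\cdots\alpha_n\,\alpha_1\cdots\alpha_{j-1}\,(i'_\Delta\alpha_j),\qquad \alpha_1,\dots,\alpha_n\in\Omega^1A .$$ Let $\overline\Omega{}^0=A/k$ and $\overline\Omega{}^m=\Omega^mA$ for $m>0$, with the induced maps $d$ and $\imath_\Delta$, and let $\overline\Omega\,\hat\otimes\,k[t,t^{-1}]=\bigoplus_{n\in\mathbb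 Z}\prod_{i\in\mathbb Z}t^i\,\overline\Omega{}^{\,n-2i}$, where $|t|=2$. Then the homology of the complex $(\overline\Omega\,\hat\otimes\,k[t,t^{-1}],\ d+t\cdot\imath_\Delta)$, whose differential has degree $+1$, is isomorphic to the reduced periodic cyclic homology of $A$ with inverted degrees: there are $k$-linear isomorphisms $$H^n\bigl(\overline\Omega\,\hat\otimes\,k[t,t^{-1}],\,d+t\cdot\imath_\Delta\bigr)\;\cong\;HP_{-n}(A)\qquad(n\in\mathbb Z),$$ which carry multiplication by $t$ to the periodicity maps $HP_{-n}(A)\to HP_{-n-2}(A)$. Here $HP_\bullet(A)$ is the homology of the product total complex of the periodic $(b,B)$-bicomplex of the normalized reduced Hochschild chains ($A/k$ in degree $0$, $A\otimes(A/k)^{\otimes m}$ in degree $m>0$), $b$ being the Hochschild differential and $B$ Connes' operator. -/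

import Mathlib

open scoped TensorProduct

noncomputable section

namespace NCForms

set_option linter.unusedSimpArgs false

universe u v

/-! ## Noncommutative differential forms -/

section Forms

variable (k : Type u) (A : Type v) [Field k] [Ring A] [Algebra k A]

/-- Relations among the generators `a = (a, 0)` and `d a = (0, a)` of the algebra of
noncommutative forms: `a ↦ a` is multiplicative and unital, and `a ↦ d a` is a derivation. -/
inductive FormRel : TensorAlgebra k (A × A) → TensorAlgebra k (A × A) → Prop
  | one : FormRel (TensorAlgebra.ι k (1, 0)) 1
  | mul (a b : A) : FormRel (TensorAlgebra.ι k (a * b, 0))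
      (TensorAlgebra.ι k (a, 0) * TensorAlgebra.ι k (b, 0))
  | leibniz (a b : A) : FormRel (TensorAlgebra.ι k (0, a * b))
      (TensorAlgebra.ι k (0, a) * TensorAlgebra.ι k (b, 0)
        + TensorAlgebra.ι k (a, 0) * TensorAlgebra.ι k (0, b))

/-- The algebra `Ω A` of noncommutative differential forms over `k`: the universal `k`-algebra
with an algebra map from `A` and a derivation `d` of `A` into it. As `Ω¹ A = ker (A ⊗ A → A)` is
the bimodule representing derivations of `A`, this is the tensor algebra `T_A (Ω¹ A)`. -/
def Omega : Type (max u v) := RingQuot (FormRel k A)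

instance : Ring (Omega k A) := inferInstanceAs (Ring (RingQuot (FormRel k A)))

instance : Algebra k (Omega k A) := inferInstanceAs (Algebra k (RingQuot (FormRel k A)))

/-- The quotient map onto `Ω A`. -/
def mkForms : TensorAlgebra k (A × A) →ₐ[k] Omega k A := RingQuot.mkAlgHom k (FormRel k A)

theorem mkForms_surjective : Function.Surjective (mkForms k A) :=
  RingQuot.mkAlgHom_surjective k (FormRel k A)

variable {A}

theorem mkForms_rel {x y : TensorAlgebra k (A × A)} (h : FormRel k A x y) :
    mkForms k A x = mkForms k A y := RingQuot.mkAlgHom_rel k h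

/-- The inclusion of zero-forms `A → Ω A`. -/
def zeroForm : A →ₗ[k] Omega k A :=
  (mkForms k A).toLinearMap ∘ₗ TensorAlgebra.ι k ∘ₗ LinearMap.inl k A A

/-- The universal derivation `A → Ω A`, `a ↦ d a`. -/
def exactForm : A →ₗ[k] Omega k A :=
  (mkForms k A).toLinearMap ∘ₗ TensorAlgebra.ι k ∘ₗ LinearMap.inr k A A

theorem zeroForm_one : zeroForm k (1 : A) = 1 := by
  have h := mkForms_rel k (FormRel.one (k := k) (A := A))
  simpa [zeroForm] using h

theorem zeroForm_mul (a b : A) : zeroForm k (a * b) = zeroForm k a * zeroForm k b := by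
  have h := mkForms_rel k (FormRel.mul (k := k) a b)
  simpa [zeroForm] using h

theorem exactForm_mul (a b : A) :
    exactForm k (a * b) = exactForm k a * zeroForm k b + zeroForm k a * exactForm k b := by
  have h := mkForms_rel k (FormRel.leibniz (k := k) a b)
  simpa [zeroForm, exactForm] using h

/-- The inclusion of zero-forms as an algebra homomorphism. -/
def zeroFormHom : A →ₐ[k] Omega k A :=
  AlgHom.ofLinearMap (zeroForm k) (zeroForm_one k) (zeroForm_mul k)

variable {k}

/-- The universal property of `Ω A`. -/
def liftForms {C : Type*} [Ring C] [Algebra k C] (f g : A →ₗ[k] C) (f_one : f 1 = 1)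
    (f_mul : ∀ a b, f (a * b) = f a * f b)
    (g_mul : ∀ a b, g (a * b) = g a * f b + f a * g b) : Omega k A →ₐ[k] C :=
  RingQuot.liftAlgHom k ⟨TensorAlgebra.lift k (f.coprod g), by
    intro x y h
    induction h with
    | one => simp [f_one]
    | mul a b => simp [f_mul]
    | leibniz a b => simp [g_mul]⟩

section
variable {C : Type*} [Ring C] [Algebra k C] (f g : A →ₗ[k] C) (f_one : f 1 = 1)
    (f_mul : ∀ a b, f (a * b) = f a * f b)
    (g_mul : ∀ a b, g (a * b) = g a * f b + f a * g b)

theorem liftForms_mkForms (x : TensorAlgebra k (A × A)) :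
    liftForms f g f_one f_mul g_mul (mkForms k A x) = TensorAlgebra.lift k (f.coprod g) x :=
  RingQuot.liftAlgHom_mkAlgHom_apply ..

theorem liftForms_zeroForm (a : A) :
    liftForms f g f_one f_mul g_mul (zeroForm k a) = f a := by
  simp [liftForms_mkForms, zeroForm]

theorem liftForms_exactForm (a : A) :
    liftForms f g f_one f_mul g_mul (exactForm k a) = g a := by
  simp [liftForms_mkForms, exactForm]

end

variable (k A)

/-- The sign automorphism of `Ω A`, multiplication by `(-1)^n` on `n`-forms. -/
def signAut : Omega k A →ₐ[k] Omega k A :=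
  liftForms (zeroForm k) (-exactForm k) (zeroForm_one k) (zeroForm_mul k) (by
    intro a b
    simp only [LinearMap.neg_apply, exactForm_mul]
    noncomm_ring)

/-- Upper triangular matrices `[[p, q], [0, r]]` with `q` depending linearly on the argument. -/
def triang {C : Type*} [Ring C] [Algebra k C] (p q r : A →ₗ[k] C) :
    A →ₗ[k] Matrix (Fin 2) (Fin 2) C where
  toFun a := !![p a, q a; 0, r a]
  map_add' a b := by ext i j; fin_cases i <;> fin_cases j <;> simp
  map_smul' c a := by ext i j; fin_cases i <;> fin_cases j <;> simp

/-- The algebra map `ω ↦ [[± ω, d ω], [0, ω]]` (sign `(-1)^n` on `n`-forms), whose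
multiplicativity is the graded Leibniz rule `d (ω η) = (d ω) η + (-1)^|ω| ω (d η)`. -/
def deRhamHom : Omega k A →ₐ[k] Matrix (Fin 2) (Fin 2) (Omega k A) :=
  liftForms (triang k A (zeroForm k) (exactForm k) (zeroForm k))
    (triang k A (-exactForm k) 0 (exactForm k))
    (by
      simp only [triang, LinearMap.coe_mk, AddHom.coe_mk, zeroForm_one]
      have h : exactForm k (1 : A) = 0 := by
        have := exactForm_mul k (1 : A) 1
        simpa [zeroForm_one] using this
      rw [h, Matrix.one_fin_two])
    (by
      intro a b
      simp [triang, zeroForm_mul, exactForm_mul, add_comm])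
    (by
      intro a b
      simp [triang, exactForm_mul, add_comm])

/-- The Karoubi–de Rham differential `d` on `Ω A`: the graded derivation of degree `1` with
`d (a) = d a` and `d (d a) = 0`, so that `d (a₀ d a₁ ⋯ d aₙ) = d a₀ d a₁ ⋯ d aₙ`. -/
def deRham : Omega k A →ₗ[k] Omega k A where
  toFun x := deRhamHom k A x 0 1
  map_add' x y := by simp
  map_smul' c x := by simp

/-- The space `Ωⁿ A` of `n`-forms, spanned by the products `a₀ d a₁ ⋯ d aₙ`. -/
def formsOfDegree (n : ℕ) : Submodule k (Omega k A) :=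
  LinearMap.range (zeroForm k (A := A)) * LinearMap.range (exactForm k (A := A)) ^ n

/-- Double derivations `A → A ⊗ A`, for the outer bimodule structure
`b (a' ⊗ a'') c = (b a') ⊗ (a'' c)` (the multiplication below is that of the algebra `A ⊗ A`). -/
structure DoubleDerivation extends A →ₗ[k] A ⊗[k] A where
  leibniz : ∀ a b, toLinearMap (a * b)
    = toLinearMap a * ((1 : A) ⊗ₜ[k] b) + (a ⊗ₜ[k] (1 : A)) * toLinearMap b

/-- The distinguished double derivation `Δ (a) = 1 ⊗ a - a ⊗ 1`. -/
def Delta : DoubleDerivation k A where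
  toLinearMap := TensorProduct.mk k A A 1 - (TensorProduct.mk k A A).flip 1
  leibniz a b := by simp [sub_mul, mul_sub]

/-- The inclusion `A ⊗ A → Ω A ⊗ Ω A`. -/
def tensorZeroForms : A ⊗[k] A →ₐ[k] Omega k A ⊗[k] Omega k A :=
  Algebra.TensorProduct.map (zeroFormHom k) (zeroFormHom k)

theorem tensorZeroForms_tmul (a b : A) :
    tensorZeroForms k A (a ⊗ₜ b) = zeroForm k a ⊗ₜ zeroForm k b := rfl

variable {k A}

/-- The algebra map `ω ↦ [[± ω ⊗ 1, 𝐢 ω], [0, 1 ⊗ ω]]` (sign `(-1)^n` on `n`-forms), whose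
multiplicativity is the Leibniz rule `𝐢 (ω η) = 𝐢 (ω) η + (-1)^|ω| ω 𝐢 (η)` for the outer
bimodule structure on `Ω A ⊗ Ω A`. -/
def contractionHom (Θ : DoubleDerivation k A) :
    Omega k A →ₐ[k] Matrix (Fin 2) (Fin 2) (Omega k A ⊗[k] Omega k A) :=
  liftForms
    (triang k A ((TensorProduct.mk k _ _).flip 1 ∘ₗ zeroForm k) 0
      (TensorProduct.mk k _ _ 1 ∘ₗ zeroForm k))
    (triang k A (-((TensorProduct.mk k _ _).flip 1 ∘ₗ exactForm k))
      ((tensorZeroForms k A).toLinearMap ∘ₗ Θ.toLinearMap)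
      (TensorProduct.mk k _ _ 1 ∘ₗ exactForm k))
    (by
      simp only [triang, LinearMap.coe_mk, AddHom.coe_mk, LinearMap.comp_apply, zeroForm_one,
        LinearMap.flip_apply, TensorProduct.mk_apply, LinearMap.zero_apply]
      rw [← Algebra.TensorProduct.one_def, Matrix.one_fin_two])
    (by
      intro a b
      simp [triang, zeroForm_mul])
    (by
      intro a b
      simp [triang, exactForm_mul, TensorProduct.add_tmul, TensorProduct.tmul_add, Θ.leibniz,
        tensorZeroForms_tmul, zeroForm_one, add_comm])

/-- The contraction with a double derivation `Θ`: the graded double derivation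
`𝐢 : Ω A → Ω A ⊗ Ω A` of degree `-1` with `𝐢 (a) = 0` and `𝐢 (d a) = Θ (a)`, that is
`𝐢 (α₁ ⋯ αₙ) = ∑ (-1)^(k-1) α₁ ⋯ α_{k-1} (i' αₖ) ⊗ (i'' αₖ) α_{k+1} ⋯ αₙ` for one-forms `αⱼ`,
where `i (u d v) = u Θ (v)`. -/
def contraction (Θ : DoubleDerivation k A) : Omega k A →ₗ[k] Omega k A ⊗[k] Omega k A where
  toFun x := contractionHom Θ x 0 1
  map_add' x y := by simp
  map_smul' c x := by simp

variable (k A)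

/-- The map `ω ⊗ η ↦ (-1)^(|ω| |η|) η ω`, written through the even and the odd part of `ω`
(see `signedSwapMul_tmul`). -/
def signedSwapMul : Omega k A ⊗[k] Omega k A →ₗ[k] Omega k A :=
  (2 : k)⁻¹ • TensorProduct.lift
    ((LinearMap.mul k (Omega k A)).flip ∘ₗ (LinearMap.id + (signAut k A).toLinearMap)
      + ((LinearMap.mul k (Omega k A)).flip.compl₂ (signAut k A).toLinearMap)
          ∘ₗ (LinearMap.id - (signAut k A).toLinearMap))

variable {k A}

/-- The reduced contraction `Ω A → Ω A` with a double derivation `Θ`: for one-forms `αⱼ`,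
`α₁ ⋯ αₙ ↦ ∑ (-1)^((k-1)(n-k+1)) (i'' αₖ) α_{k+1} ⋯ αₙ α₁ ⋯ α_{k-1} (i' αₖ)`. -/
def reducedContraction (Θ : DoubleDerivation k A) : Omega k A →ₗ[k] Omega k A :=
  signedSwapMul k A ∘ₗ contraction Θ

/-! ### Degrees -/

theorem signAut_zeroForm (a : A) : signAut k A (zeroForm k a) = zeroForm k a :=
  liftForms_zeroForm ..

theorem signAut_exactForm (a : A) : signAut k A (exactForm k a) = -exactForm k a :=
  liftForms_exactForm ..

theorem signedSwapMul_apply (x y : Omega k A) : signedSwapMul k A (x ⊗ₜ y) =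
    (2 : k)⁻¹ • (y * (x + signAut k A x) + signAut k A y * (x - signAut k A x)) := by
  simp [signedSwapMul, mul_add, mul_sub]

theorem signAut_exact_pow (n : ℕ) {x : Omega k A}
    (hx : x ∈ LinearMap.range (exactForm k (A := A)) ^ n) :
    signAut k A x = (-1 : k) ^ n • x := by
  induction hx using Submodule.pow_induction_on_left' with
  | algebraMap r => simp
  | add x y i hx hy ihx ihy => simp [ihx, ihy]
  | mem_mul m hm i x hx ih =>
    obtain ⟨a, rfl⟩ := hm
    rw [map_mul, ih, signAut_exactForm, pow_succ]
    simp

theorem signAut_of_degree {n : ℕ} {x : Omega k A} (hx : x ∈ formsOfDegree k A n) :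
    signAut k A x = (-1 : k) ^ n • x := by
  induction hx using Submodule.mul_induction_on' with
  | mem_mul_mem a ha y hy =>
    obtain ⟨a, rfl⟩ := ha
    rw [map_mul, signAut_exact_pow n hy, signAut_zeroForm, mul_smul_comm]
  | add x _ y _ hx hy => rw [map_add, hx, hy, smul_add]

theorem signedSwapMul_tmul [CharZero k] {p q : ℕ} {x y : Omega k A}
    (hx : x ∈ formsOfDegree k A p) (hy : y ∈ formsOfDegree k A q) :
    signedSwapMul k A (x ⊗ₜ y) = (-1 : k) ^ (p * q) • (y * x) := by
  rw [signedSwapMul_apply, signAut_of_degree hx, signAut_of_degree hy]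
  rcases Nat.even_or_odd p with hp | hp <;> rcases Nat.even_or_odd q with hq | hq
  all_goals
    first
    | have h : (-1 : k) ^ (p * q) = 1 := (hp.mul_right q).neg_one_pow
    | have h : (-1 : k) ^ (p * q) = 1 := (hq.mul_left p).neg_one_pow
    | have h : (-1 : k) ^ (p * q) = -1 := (Odd.mul hp hq).neg_one_pow
    rw [h, hp.neg_one_pow, hq.neg_one_pow]
    simp only [one_smul, neg_smul, add_neg_cancel, sub_self, mul_zero, zero_add, add_zero,
      sub_neg_eq_add, mul_add, neg_mul, ← two_smul k (y * x), ← two_smul k (-(y * x))]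
    simp [smul_smul]

theorem deRham_mul (x y : Omega k A) :
    deRham k A (x * y) = deRham k A x * y + signAut k A x * deRham k A y := by
  have h00 : ∀ x : Omega k A, deRhamHom k A x 0 0 = signAut k A x
      ∧ deRhamHom k A x 1 0 = 0 ∧ deRhamHom k A x 1 1 = x := by
    intro x
    obtain ⟨x, rfl⟩ := mkForms_surjective k A x
    induction x using TensorAlgebra.induction with
    | algebraMap r =>
      simp only [AlgHom.commutes, Matrix.algebraMap_matrix_apply]
      simp
    | ι p =>
      obtain ⟨a, b⟩ := p
      have hp : mkForms k A (TensorAlgebra.ι k (a, b))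
          = zeroForm k a + exactForm k b := by
        simp only [zeroForm, exactForm, LinearMap.comp_apply, AlgHom.toLinearMap_apply,
          ← map_add]
        simp
      rw [hp]
      simp [deRhamHom, liftForms_zeroForm, liftForms_exactForm, triang, signAut_zeroForm,
        signAut_exactForm]
    | mul a b ha hb => simp [Matrix.mul_apply, Fin.sum_univ_two, ha, hb]
    | add a b ha hb => simp [ha, hb]
  change deRhamHom k A (x * y) 0 1 = _
  rw [map_mul, Matrix.mul_apply, Fin.sum_univ_two, (h00 x).1, (h00 y).2.2, add_comm]
  rfl

theorem deRham_zeroForm (a : A) : deRham k A (zeroForm k a) = exactForm k a := by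
  simp [deRham, deRhamHom, liftForms_zeroForm, triang]

theorem deRham_exactForm (a : A) : deRham k A (exactForm k a) = 0 := by
  simp [deRham, deRhamHom, liftForms_exactForm, triang]

theorem deRham_algebraMap (r : k) : deRham k A (algebraMap k _ r) = 0 := by
  simp [deRham, Matrix.algebraMap_matrix_apply]

theorem deRham_exact_pow (n : ℕ) {x : Omega k A}
    (hx : x ∈ LinearMap.range (exactForm k (A := A)) ^ n) : deRham k A x = 0 := by
  induction hx using Submodule.pow_induction_on_left' with
  | algebraMap r => exact deRham_algebraMap r
  | add x y i hx hy ihx ihy => simp [ihx, ihy]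
  | mem_mul m hm i x hx ih =>
    obtain ⟨a, rfl⟩ := hm
    rw [deRham_mul, ih, deRham_exactForm]
    simp

theorem one_le_zeroForms : (1 : Submodule k (Omega k A)) ≤ LinearMap.range (zeroForm k) := by
  rw [Submodule.one_le]
  exact ⟨1, zeroForm_one k⟩

theorem deRham_mem {n : ℕ} {x : Omega k A} (hx : x ∈ formsOfDegree k A n) :
    deRham k A x ∈ formsOfDegree k A (n + 1) := by
  induction hx using Submodule.mul_induction_on' with
  | mem_mul_mem a ha y hy =>
    obtain ⟨a, rfl⟩ := ha
    rw [deRham_mul, deRham_exact_pow n hy, mul_zero, add_zero, deRham_zeroForm]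
    have h : exactForm k a * y ∈ LinearMap.range (exactForm k (A := A)) ^ (n + 1) := by
      rw [pow_succ']
      exact Submodule.mul_mem_mul ⟨a, rfl⟩ hy
    have := Submodule.mul_mem_mul (one_le_zeroForms (k := k) (A := A) (Submodule.one_le.1 le_rfl)) h
    rwa [one_mul] at this
  | add x _ y _ hx hy => rw [map_add]; exact add_mem hx hy

theorem formsOfDegree_mul_le (p q : ℕ) :
    formsOfDegree k A p * formsOfDegree k A q ≤ formsOfDegree k A (p + q) := by
  set R := LinearMap.range (zeroForm k (A := A)) with hR
  set S := LinearMap.range (exactForm k (A := A)) with hS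
  have hRR : R * R ≤ R := by
    rw [Submodule.mul_le]
    rintro _ ⟨a, rfl⟩ _ ⟨b, rfl⟩
    exact ⟨a * b, zeroForm_mul k a b⟩
  have hSR : S * R ≤ R * S := by
    rw [Submodule.mul_le]
    rintro _ ⟨a, rfl⟩ _ ⟨b, rfl⟩
    have h : exactForm k a * zeroForm k b
        = zeroForm k 1 * exactForm k (a * b) - zeroForm k a * exactForm k b := by
      rw [exactForm_mul, zeroForm_one]; noncomm_ring
    rw [h]
    exact sub_mem (Submodule.mul_mem_mul ⟨1, rfl⟩ ⟨_, rfl⟩)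
      (Submodule.mul_mem_mul ⟨a, rfl⟩ ⟨b, rfl⟩)
  have hSpR : ∀ p : ℕ, S ^ p * R ≤ R * S ^ p := by
    intro p
    induction p with
    | zero => simp
    | succ p ih =>
      calc S ^ (p + 1) * R = S ^ p * (S * R) := by rw [pow_succ, mul_assoc]
        _ ≤ S ^ p * (R * S) := mul_le_mul_right hSR _
        _ = (S ^ p * R) * S := by rw [mul_assoc]
        _ ≤ (R * S ^ p) * S := mul_le_mul_left ih _
        _ = R * S ^ (p + 1) := by rw [pow_succ, mul_assoc]
  calc R * S ^ p * (R * S ^ q) = R * (S ^ p * R) * S ^ q := by simp only [mul_assoc]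
    _ ≤ R * (R * S ^ p) * S ^ q := mul_le_mul_left (mul_le_mul_right (hSpR p) _) _
    _ = (R * R) * S ^ (p + q) := by rw [pow_add]; simp only [mul_assoc]
    _ ≤ R * S ^ (p + q) := mul_le_mul_left hRR _

theorem contraction_mul (Θ : DoubleDerivation k A) (x y : Omega k A) :
    contraction Θ (x * y) = contraction Θ x * ((1 : Omega k A) ⊗ₜ[k] y)
      + (signAut k A x ⊗ₜ[k] (1 : Omega k A)) * contraction Θ y := by
  have h00 : ∀ x : Omega k A, contractionHom Θ x 0 0 = signAut k A x ⊗ₜ 1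
      ∧ contractionHom Θ x 1 0 = 0 ∧ contractionHom Θ x 1 1 = 1 ⊗ₜ x := by
    intro x
    obtain ⟨x, rfl⟩ := mkForms_surjective k A x
    induction x using TensorAlgebra.induction with
    | algebraMap r =>
      simp only [AlgHom.commutes, Matrix.algebraMap_matrix_apply]
      simp [Algebra.TensorProduct.algebraMap_apply, Algebra.TensorProduct.one_def,
        Algebra.algebraMap_eq_smul_one, TensorProduct.smul_tmul]
    | ι p =>
      obtain ⟨a, b⟩ := p
      have hp : mkForms k A (TensorAlgebra.ι k (a, b))
          = zeroForm k a + exactForm k b := by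
        simp only [zeroForm, exactForm, LinearMap.comp_apply, AlgHom.toLinearMap_apply,
          ← map_add]
        simp
      rw [hp]
      simp [contractionHom, liftForms_zeroForm, liftForms_exactForm, triang, signAut_zeroForm,
        signAut_exactForm, TensorProduct.tmul_add, TensorProduct.add_tmul, TensorProduct.sub_tmul,
        TensorProduct.neg_tmul, sub_eq_add_neg]
    | mul a b ha hb => simp [Matrix.mul_apply, Fin.sum_univ_two, ha, hb]
    | add a b ha hb => simp [ha, hb, TensorProduct.tmul_add, TensorProduct.add_tmul]
  change contractionHom Θ (x * y) 0 1 = _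
  rw [map_mul, Matrix.mul_apply, Fin.sum_univ_two, (h00 x).1, (h00 y).2.2, add_comm]
  rfl

theorem contraction_zeroForm (Θ : DoubleDerivation k A) (a : A) :
    contraction Θ (zeroForm k a) = 0 := by
  simp [contraction, contractionHom, liftForms_zeroForm, triang]

theorem contraction_exactForm (Θ : DoubleDerivation k A) (a : A) :
    contraction Θ (exactForm k a)
      = tensorZeroForms k A (Θ.toLinearMap a) := by
  simp [contraction, contractionHom, liftForms_exactForm, triang]

theorem contraction_algebraMap (Θ : DoubleDerivation k A) (r : k) :
    contraction Θ (algebraMap k _ r) = 0 := by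
  simp [contraction, Matrix.algebraMap_matrix_apply]

variable (k A) in
/-- Tensors of total degree `n` in `Ω A ⊗ Ω A`. -/
def tensorsOfDegree (n : ℕ) : Submodule k (Omega k A ⊗[k] Omega k A) :=
  Submodule.span k {z | ∃ p q, p + q = n ∧ ∃ x ∈ formsOfDegree k A p,
    ∃ y ∈ formsOfDegree k A q, z = x ⊗ₜ[k] y}

theorem tensorsOfDegree_left {m n : ℕ} {x : Omega k A} {z : Omega k A ⊗[k] Omega k A}
    (hx : x ∈ formsOfDegree k A m) (hz : z ∈ tensorsOfDegree k A n) :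
    (x ⊗ₜ[k] (1 : Omega k A)) * z ∈ tensorsOfDegree k A (m + n) := by
  induction hz using Submodule.span_induction with
  | mem z h =>
    obtain ⟨p, q, rfl, x', hx', y, hy, rfl⟩ := h
    refine Submodule.subset_span ⟨m + p, q, by ring, x * x',
      formsOfDegree_mul_le _ _ (Submodule.mul_mem_mul hx hx'), y, hy, by simp⟩
  | zero => simp
  | add a b _ _ ha hb => rw [mul_add]; exact add_mem ha hb
  | smul r a _ ha => rw [mul_smul_comm]; exact Submodule.smul_mem _ _ ha

theorem tensorsOfDegree_right {m n : ℕ} {y : Omega k A} {z : Omega k A ⊗[k] Omega k A}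
    (hy : y ∈ formsOfDegree k A m) (hz : z ∈ tensorsOfDegree k A n) :
    z * ((1 : Omega k A) ⊗ₜ[k] y) ∈ tensorsOfDegree k A (n + m) := by
  induction hz using Submodule.span_induction with
  | mem z h =>
    obtain ⟨p, q, rfl, x, hx, y', hy', rfl⟩ := h
    refine Submodule.subset_span ⟨p, q + m, by ring, x, hx, y' * y,
      formsOfDegree_mul_le _ _ (Submodule.mul_mem_mul hy' hy), by simp⟩
  | zero => simp
  | add a b _ _ ha hb => rw [add_mul]; exact add_mem ha hb
  | smul r a _ ha => rw [smul_mul_assoc]; exact Submodule.smul_mem _ _ ha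

theorem zeroForm_mem (a : A) : zeroForm k a ∈ formsOfDegree k A 0 := by
  rw [formsOfDegree, pow_zero, mul_one]
  exact ⟨a, rfl⟩

theorem exact_pow_le (n : ℕ) :
    LinearMap.range (exactForm k (A := A)) ^ n ≤ formsOfDegree k A n := by
  have := mul_le_mul_left (one_le_zeroForms (k := k) (A := A))
    (LinearMap.range (exactForm k (A := A)) ^ n)
  rwa [one_mul] at this

theorem contraction_exact_mem (Θ : DoubleDerivation k A) (a : A) :
    contraction Θ (exactForm k a) ∈ tensorsOfDegree k A 0 := by
  rw [contraction_exactForm]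
  induction Θ.toLinearMap a using TensorProduct.induction_on with
  | zero => simp
  | tmul x y =>
    exact Submodule.subset_span ⟨0, 0, rfl, _, zeroForm_mem x, _, zeroForm_mem y, rfl⟩
  | add x y hx hy => rw [map_add]; exact add_mem hx hy

theorem contraction_exact_pow (Θ : DoubleDerivation k A) (n : ℕ) {x : Omega k A}
    (hx : x ∈ LinearMap.range (exactForm k (A := A)) ^ n) :
    (n = 0 → contraction Θ x = 0) ∧ ∀ m, n = m + 1 → contraction Θ x ∈ tensorsOfDegree k A m := by
  induction hx using Submodule.pow_induction_on_left' with
  | algebraMap r => simp [contraction_algebraMap]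
  | add x y i hx hy ihx ihy =>
    refine ⟨fun h => by simp [ihx.1 h, ihy.1 h], fun m h => ?_⟩
    rw [map_add]
    exact add_mem (ihx.2 m h) (ihy.2 m h)
  | mem_mul s hs i x hx ih =>
    obtain ⟨a, rfl⟩ := hs
    refine ⟨by simp, fun m hm => ?_⟩
    obtain rfl : i = m := by omega
    rw [contraction_mul]
    refine add_mem ?_ ?_
    · have := tensorsOfDegree_right (exact_pow_le i hx) (contraction_exact_mem Θ a)
      rwa [zero_add] at this
    · cases i with
      | zero => simp [ih.1 rfl]
      | succ j =>
        rw [signAut_exactForm, add_comm j 1]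
        refine tensorsOfDegree_left (neg_mem ?_) (ih.2 j rfl)
        exact exact_pow_le 1 (by rw [pow_one]; exact ⟨a, rfl⟩)

theorem contraction_mem (Θ : DoubleDerivation k A) {n : ℕ} {x : Omega k A}
    (hx : x ∈ formsOfDegree k A (n + 1)) : contraction Θ x ∈ tensorsOfDegree k A n := by
  induction hx using Submodule.mul_induction_on' with
  | mem_mul_mem a ha y hy =>
    obtain ⟨a, rfl⟩ := ha
    rw [contraction_mul, contraction_zeroForm, zero_mul, zero_add, signAut_zeroForm]
    have := tensorsOfDegree_left (zeroForm_mem a) ((contraction_exact_pow Θ _ hy).2 n rfl)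
    rwa [zero_add] at this
  | add x _ y _ hx hy => rw [map_add]; exact add_mem hx hy

theorem reducedContraction_mem (Θ : DoubleDerivation k A) {n : ℕ} {x : Omega k A}
    (hx : x ∈ formsOfDegree k A (n + 1)) : reducedContraction Θ x ∈ formsOfDegree k A n := by
  have h := contraction_mem Θ hx
  change signedSwapMul k A (contraction Θ x) ∈ _
  generalize contraction Θ x = z at h
  induction h using Submodule.span_induction with
  | mem z h =>
    obtain ⟨p, q, rfl, x, hx, y, hy, rfl⟩ := h
    have key : y * x ∈ formsOfDegree k A (p + q) := by
      rw [add_comm]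
      exact formsOfDegree_mul_le _ _ (Submodule.mul_mem_mul hy hx)
    rw [signedSwapMul_apply, signAut_of_degree hx, signAut_of_degree hy]
    simp only [mul_add, mul_sub, smul_mul_assoc, mul_smul_comm]
    refine Submodule.smul_mem _ _ (add_mem (add_mem ?_ ?_) (sub_mem ?_ ?_)) <;>
      repeat first | exact key | apply Submodule.smul_mem
  | zero => simp
  | add a b _ _ ha hb => rw [map_add]; exact add_mem ha hb
  | smul r a _ ha => rw [map_smul]; exact Submodule.smul_mem _ _ ha

/-! ### Reduced forms -/

variable (k A)

/-- The scalars `k = k · 1` inside `Ω⁰ A = A`, and zero inside `Ωⁿ A` for `n > 0`. -/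
def scalarForms : ∀ n : ℕ, Submodule k (formsOfDegree k A n)
  | 0 => Submodule.comap (formsOfDegree k A 0).subtype 1
  | _ + 1 => ⊥

/-- Reduced forms: `A / k` in degree `0`, and `Ωⁿ A` in degree `n > 0`. -/
def ReducedForms (n : ℕ) : Type (max u v) := formsOfDegree k A n ⧸ scalarForms k A n

instance (n : ℕ) : AddCommGroup (ReducedForms k A n) :=
  inferInstanceAs (AddCommGroup (formsOfDegree k A n ⧸ scalarForms k A n))

instance (n : ℕ) : Module k (ReducedForms k A n) :=
  inferInstanceAs (Module k (formsOfDegree k A n ⧸ scalarForms k A n))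

/-- The differential `d` on reduced forms. -/
def reducedDeRham (n : ℕ) : ReducedForms k A n →ₗ[k] ReducedForms k A (n + 1) :=
  Submodule.mapQ _ _ ((deRham k A).restrict fun _ hx => deRham_mem hx) (by
    cases n with
    | zero =>
      rintro ⟨x, hx⟩ h
      obtain ⟨r, rfl⟩ := Submodule.mem_one.1 h
      simp only [scalarForms, Submodule.mem_comap, Submodule.mem_bot]
      exact Subtype.ext (deRham_algebraMap r)
    | succ n => exact bot_le)

variable {k A} in
/-- The reduced contraction with `Θ`, on reduced forms. -/
def reducedContractionBar (Θ : DoubleDerivation k A) (n : ℕ) :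
    ReducedForms k A (n + 1) →ₗ[k] ReducedForms k A n :=
  Submodule.mapQ _ _ ((reducedContraction Θ).restrict fun _ hx => reducedContraction_mem Θ hx)
    bot_le

end Forms

/-! ## The completed tensor product with `k[t, t⁻¹]` -/

section Hat

variable {k : Type*} [Field k] {M : ℕ → Type*} [∀ m, AddCommGroup (M m)] [∀ m, Module k (M m)]

variable (k M) in
/-- The degree `n` part `∏ᵢ tⁱ M^(n-2i)` of `M ⊗̂ k[t, t⁻¹]`, where `|t| = 2`: the element
`∑ᵢ tⁱ xᵢ` is the family `i ↦ xᵢ`, with `xᵢ` supported in degree `n - 2i`. -/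
def hatDegree (n : ℤ) : Submodule k (ℤ → ∀ m, M m) where
  carrier := {x | ∀ (i : ℤ) (m : ℕ), (m : ℤ) ≠ n - 2 * i → x i m = 0}
  zero_mem' _ _ _ := rfl
  add_mem' hx hy i m h := by simp [hx i m h, hy i m h]
  smul_mem' c x hx i m h := by simp [hx i m h]

/-- The map of degree `1` on families given by maps `M^m → M^(m+1)`. -/
def raise (f : ∀ m, M m →ₗ[k] M (m + 1)) : (∀ m, M m) →ₗ[k] (∀ m, M m) :=
  LinearMap.pi fun m => match m with
    | 0 => 0
    | m + 1 => f m ∘ₗ LinearMap.proj m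

/-- The map of degree `-1` on families given by maps `M^(m+1) → M^m` (and zero on `M^0`). -/
def lower (g : ∀ m, M (m + 1) →ₗ[k] M m) : (∀ m, M m) →ₗ[k] (∀ m, M m) :=
  LinearMap.pi fun m => g m ∘ₗ LinearMap.proj (m + 1)

variable (f : ∀ m, M m →ₗ[k] M (m + 1)) (g : ∀ m, M (m + 1) →ₗ[k] M m)

/-- The operator `f + t g`, of degree `1`: the coefficient of `tⁱ` in `(f + t g) x` is
`f xᵢ + g xᵢ₋₁`. -/
def hatDifferential : (ℤ → ∀ m, M m) →ₗ[k] (ℤ → ∀ m, M m) :=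
  LinearMap.pi fun i => raise f ∘ₗ LinearMap.proj i + lower g ∘ₗ LinearMap.proj (i - 1)

/-- Cocycles of degree `n` of `(M ⊗̂ k[t, t⁻¹], f + t g)`. -/
def hatCocycles (n : ℤ) : Submodule k (ℤ → ∀ m, M m) :=
  hatDegree k M n ⊓ LinearMap.ker (hatDifferential f g)

/-- Coboundaries of degree `n` of `(M ⊗̂ k[t, t⁻¹], f + t g)`. -/
def hatCoboundaries (n : ℤ) : Submodule k (ℤ → ∀ m, M m) :=
  (hatDegree k M (n - 1)).map (hatDifferential f g)

/-- The degree `n` homology of the complex `(M ⊗̂ k[t, t⁻¹], f + t g)`, with differential of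
degree `1`. -/
abbrev HatHomology (n : ℤ) : Type _ :=
  hatCocycles f g n ⧸ (hatCoboundaries f g n).submoduleOf (hatCocycles f g n)

/-- Multiplication by `t` on homology. -/
def mulT (n : ℤ) : HatHomology f g n →ₗ[k] HatHomology f g (n + 2) :=
  Submodule.mapQ _ _
    ((LinearMap.funLeft k (∀ m, M m) (fun i : ℤ => i - 1)).restrict (by
      rintro x ⟨hx, hx'⟩
      refine ⟨fun i m h => hx (i - 1) m (by omega), ?_⟩
      rw [SetLike.mem_coe, LinearMap.mem_ker] at hx' ⊢
      ext i : 1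
      exact congrFun hx' (i - 1)))
    (by
      rintro ⟨x, hx⟩ ⟨y, hy, rfl⟩
      refine ⟨fun i => y (i - 1), fun i m h => hy (i - 1) m (by omega), rfl⟩)

end Hat

section FormsHomology

variable (k : Type u) (A : Type v) [Field k] [Ring A] [Algebra k A]

/-- The degree `n` homology of the complex `(Ω̄ ⊗̂ k[t, t⁻¹], d + t ı_Δ)`. -/
abbrev FormsHomology (n : ℤ) : Type (max u v) :=
  HatHomology (M := ReducedForms k A) (reducedDeRham k A) (reducedContractionBar (Delta k A)) n

/-- Multiplication by `t` on the homology of `(Ω̄ ⊗̂ k[t, t⁻¹], d + t ı_Δ)`. -/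
def formsMulT (n : ℤ) : FormsHomology k A n →ₗ[k] FormsHomology k A (n + 2) :=
  mulT (M := ReducedForms k A) (reducedDeRham k A) (reducedContractionBar (Delta k A)) n

end FormsHomology

/-! ## Reduced periodic cyclic homology -/

section Cyclic

variable (k : Type u) (A : Type v) [Field k] [Ring A] [Algebra k A]

/-- Hochschild chains `A^{⊗ (n+1)}`. -/
abbrev Chains (n : ℕ) : Type (max u v) := PiTensorProduct k (fun _ : Fin (n + 1) => A)

variable {A}

/-- The `j`-th face of a word: `(a₀, …, aⱼ aⱼ₊₁, …, aₙ₊₁)` for `j ≤ n`, and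
`(aₙ₊₁ a₀, a₁, …, aₙ)` for `j = n + 1`. -/
def face {n : ℕ} (j : Fin (n + 2)) (a : Fin (n + 2) → A) (l : Fin (n + 1)) : A :=
  if j = Fin.last (n + 1) then
    if l = 0 then a (Fin.last (n + 1)) * a 0 else a l.castSucc
  else if (l : ℕ) < j then a l.castSucc
  else if (l : ℕ) = j then a l.castSucc * a l.succ
  else a l.succ

theorem face_update {n : ℕ} (j : Fin (n + 2)) (a : Fin (n + 2) → A) (i : Fin (n + 2)) :
    ∃ (l : Fin (n + 1)) (L : A →ₗ[k] A), ∀ x,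
      face j (Function.update a i x) = Function.update (face j a) l (L x) := by
  by_cases hj : j = Fin.last (n + 1)
  · subst hj
    by_cases hi : i = Fin.last (n + 1)
    · subst hi
      refine ⟨0, LinearMap.mulRight k (a 0), fun x => funext fun l => ?_⟩
      by_cases hl : l = 0
      · subst hl
        simp [face, Function.update_apply, Fin.ext_iff]
      · simp [face, hl, Function.update_apply, Fin.ext_iff, l.isLt.ne]
    · by_cases h0 : i = 0
      · subst h0
        refine ⟨0, LinearMap.mulLeft k (a (Fin.last _)), fun x => funext fun l => ?_⟩
        by_cases hl : l = 0
        · subst hl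
          simp [face, Function.update_apply, Fin.ext_iff]
        · have : (l : ℕ) ≠ 0 := fun h => hl (Fin.ext h)
          simp [face, hl, Function.update_apply, Fin.ext_iff, this]
      · have hi' : (i : ℕ) < n + 1 := by
          have := i.isLt
          have : (i : ℕ) ≠ n + 1 := fun h => hi (Fin.ext h)
          omega
        have h0' : (i : ℕ) ≠ 0 := fun h => h0 (Fin.ext h)
        refine ⟨⟨i, hi'⟩, LinearMap.id, fun x => funext fun l => ?_⟩
        by_cases hl : l = 0
        · subst hl
          have h1 : ¬ (n + 1 = (i : ℕ)) := by omega
          have h2 : ¬ (0 = (i : ℕ)) := by omega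
          simp [face, Function.update_apply, Fin.ext_iff, h1, h2]
        · simp [face, hl, Function.update_apply, Fin.ext_iff]
  · have hj' : (j : ℕ) < n + 1 := by
      have := j.isLt
      have : (j : ℕ) ≠ n + 1 := fun h => hj (Fin.ext h)
      omega
    have hi' := i.isLt
    rcases lt_trichotomy (i : ℕ) j with h | h | h
    · refine ⟨⟨i, by omega⟩, LinearMap.id, fun x => funext fun l => ?_⟩
      simp only [face, hj, if_false, Function.update_apply, Fin.ext_iff, Fin.val_castSucc,
        Fin.val_succ, LinearMap.id_apply]
      split_ifs <;> first | rfl | omega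
    · refine ⟨⟨j, hj'⟩, LinearMap.mulRight k (a ⟨j + 1, by omega⟩), fun x => funext fun l => ?_⟩
      simp only [face, hj, if_false, Function.update_apply, Fin.ext_iff, Fin.val_castSucc,
        Fin.val_succ, LinearMap.mulRight_apply]
      split_ifs <;> first | rfl | omega | (congr 2; ext; simp; omega)
    · by_cases h1 : (i : ℕ) = j + 1
      · refine ⟨⟨j, hj'⟩, LinearMap.mulLeft k (a ⟨j, by omega⟩), fun x => funext fun l => ?_⟩
        simp only [face, hj, if_false, Function.update_apply, Fin.ext_iff, Fin.val_castSucc,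
          Fin.val_succ, LinearMap.mulLeft_apply]
        split_ifs <;> first | rfl | omega | (congr 2; ext; simp; omega)
      · refine ⟨⟨i - 1, by omega⟩, LinearMap.id, fun x => funext fun l => ?_⟩
        simp only [face, hj, if_false, Function.update_apply, Fin.ext_iff, Fin.val_castSucc,
          Fin.val_succ, LinearMap.id_apply]
        split_ifs <;> first | rfl | omega

/-- The `j`-th face as a multilinear map. -/
def faceMultilinear {n : ℕ} (j : Fin (n + 2)) :
    MultilinearMap k (fun _ : Fin (n + 2) => A) (Chains k A n) where
  toFun a := PiTensorProduct.tprod k (face j a)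
  map_update_add' {inst} a i x y := by
    obtain rfl : inst = instDecidableEqFin (n + 2) := Subsingleton.elim _ _
    obtain ⟨l, L, h⟩ := face_update k j a i
    rw [h, h, h, map_add, MultilinearMap.map_update_add]
  map_update_smul' {inst} a i c x := by
    obtain rfl : inst = instDecidableEqFin (n + 2) := Subsingleton.elim _ _
    obtain ⟨l, L, h⟩ := face_update k j a i
    rw [h, h, map_smul, MultilinearMap.map_update_smul]

variable (A) in
/-- The Hochschild differential `b = ∑ⱼ (-1)ʲ dⱼ` on Hochschild chains. -/
def hochschildB (n : ℕ) : Chains k A (n + 1) →ₗ[k] Chains k A n :=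
  ∑ j : Fin (n + 2), (-1 : k) ^ (j : ℕ) • PiTensorProduct.lift (faceMultilinear k j)

/-- The word `(1, aᵢ, …, aₙ, a₀, …, aᵢ₋₁)`; the index `l + i` is taken modulo `n + 1`. -/
def rotated {n : ℕ} (i : Fin (n + 1)) (a : Fin (n + 1) → A) : Fin (n + 2) → A :=
  Fin.cons 1 fun l : Fin (n + 1) => a (l + i)

theorem rotated_update {n : ℕ} (i : Fin (n + 1)) (a : Fin (n + 1) → A) (j : Fin (n + 1)) (x : A) :
    rotated i (Function.update a j x) = Function.update (rotated i a) (j - i).succ x := by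
  rw [rotated, rotated, ← Fin.cons_update]
  congr 1
  funext l
  simp only [Function.update_apply, eq_sub_iff_add_eq]

/-- The rotated word as a multilinear map. -/
def rotatedMultilinear {n : ℕ} (i : Fin (n + 1)) :
    MultilinearMap k (fun _ : Fin (n + 1) => A) (Chains k A (n + 1)) where
  toFun a := PiTensorProduct.tprod k (rotated i a)
  map_update_add' {inst} a j x y := by
    obtain rfl : inst = instDecidableEqFin (n + 1) := Subsingleton.elim _ _
    rw [rotated_update, rotated_update, rotated_update, MultilinearMap.map_update_add]
  map_update_smul' {inst} a j c x := by
    obtain rfl : inst = instDecidableEqFin (n + 1) := Subsingleton.elim _ _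
    rw [rotated_update, rotated_update, MultilinearMap.map_update_smul]

variable (A) in
/-- Connes' operator
`B (a₀, …, aₙ) = ∑ᵢ (-1)^(n i) (1, aᵢ, …, aₙ, a₀, …, aᵢ₋₁)` (in its form for normalized chains). -/
def connesB (n : ℕ) : Chains k A n →ₗ[k] Chains k A (n + 1) :=
  ∑ i : Fin (n + 1), (-1 : k) ^ (n * (i : ℕ)) • PiTensorProduct.lift (rotatedMultilinear k i)

variable (A) in
/-- The span of the words with `aᵢ = 1` for some `i > 0`, and in degree `0` the scalars `k · 1`. -/
def degenerateChains (n : ℕ) : Submodule k (Chains k A n) :=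
  Submodule.span k {z | ∃ a : Fin (n + 1) → A,
    ((∃ i, i ≠ 0 ∧ a i = 1) ∨ (n = 0 ∧ a 0 = 1)) ∧ z = PiTensorProduct.tprod k a}

variable (A) in
/-- Normalized reduced Hochschild chains: `A ⊗ (A/k)^{⊗ n}` for `n > 0`, and `A/k` for `n = 0`.
They are the quotient of the normalized chains of `A` by those of `k`. -/
def ReducedChains (n : ℕ) : Type (max u v) := Chains k A n ⧸ degenerateChains k A n

instance (n : ℕ) : AddCommGroup (ReducedChains k A n) :=
  inferInstanceAs (AddCommGroup (Chains k A n ⧸ degenerateChains k A n))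

instance (n : ℕ) : Module k (ReducedChains k A n) :=
  inferInstanceAs (Module k (Chains k A n ⧸ degenerateChains k A n))

theorem hochschildB_tprod (n : ℕ) (a : Fin (n + 2) → A) :
    hochschildB k A n (PiTensorProduct.tprod k a)
      = ∑ j : Fin (n + 2), (-1 : k) ^ (j : ℕ) • PiTensorProduct.tprod k (face j a) := by
  simp [hochschildB, faceMultilinear, LinearMap.sum_apply]

theorem connesB_tprod (n : ℕ) (a : Fin (n + 1) → A) :
    connesB k A n (PiTensorProduct.tprod k a)
      = ∑ i : Fin (n + 1), (-1 : k) ^ (n * (i : ℕ)) • PiTensorProduct.tprod k (rotated i a) := by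
  simp [connesB, rotatedMultilinear, LinearMap.sum_apply]

theorem face_degenerate {n : ℕ} (a : Fin (n + 2) → A) (i : Fin (n + 1)) (hi : a i.succ = 1)
    (j : Fin (n + 2)) (h1 : j ≠ i.castSucc) (h2 : j ≠ i.succ) : ∃ l, l ≠ 0 ∧ face j a l = 1 := by
  have hi' := i.isLt
  have hj' := j.isLt
  simp only [ne_eq, Fin.ext_iff, Fin.val_castSucc, Fin.val_succ] at h1 h2
  by_cases hlt : (j : ℕ) < i
  · refine ⟨i, by rintro rfl; exact absurd hlt (Nat.not_lt_zero _), ?_⟩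
    have hj : j ≠ Fin.last (n + 1) := by
      rintro rfl
      rw [Fin.val_last] at hlt
      omega
    rw [face, if_neg hj, if_neg (by omega), if_neg (by omega), hi]
  · refine ⟨⟨i + 1, by omega⟩, fun h => Nat.succ_ne_zero _ (Fin.ext_iff.1 h), ?_⟩
    have hs : (⟨i + 1, by omega⟩ : Fin (n + 1)).castSucc = i.succ := by ext; simp
    by_cases hj : j = Fin.last (n + 1)
    · rw [face, if_pos hj, if_neg (fun h => Nat.succ_ne_zero _ (Fin.ext_iff.1 h)), hs, hi]
    · rw [face, if_neg hj, if_pos (by simp only; omega), hs, hi]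

theorem face_cancel {n : ℕ} (a : Fin (n + 2) → A) (i : Fin (n + 1)) (hi : a i.succ = 1) :
    face i.castSucc a = face i.succ a := by
  funext l
  have hi' := i.isLt
  have hl' := l.isLt
  have hc : i.castSucc ≠ Fin.last (n + 1) := by simp [Fin.ext_iff]; omega
  rw [face, if_neg hc]
  simp only [Fin.val_castSucc]
  by_cases hlast : i.succ = Fin.last (n + 1)
  · rw [face, if_pos hlast, ← hlast, hi, one_mul]
    have hin : (i : ℕ) = n := by simpa [Fin.ext_iff] using hlast
    by_cases hli : (l : ℕ) < i
    · rw [if_pos hli]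
      split_ifs with h0
      · subst h0; rfl
      · rfl
    · have hli' : l = i := Fin.ext (by omega)
      subst hli'
      rw [if_neg hli, if_pos rfl, hi, mul_one]
      split_ifs with h0
      · subst h0; rfl
      · rfl
  · rw [face, if_neg hlast]
    simp only [Fin.val_succ]
    rcases lt_trichotomy (l : ℕ) i with h | h | h
    · rw [if_pos h, if_pos (by omega)]
    · obtain rfl : l = i := Fin.ext h
      rw [if_neg (by omega), if_pos rfl, if_pos (by omega), hi, mul_one]
    · rw [if_neg (by omega), if_neg (by omega), if_neg (by omega)]
      by_cases h1 : (l : ℕ) = i + 1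
      · have hs : l.castSucc = i.succ := by ext; simp [h1]
        rw [if_pos h1, hs, hi, one_mul]
      · rw [if_neg h1]

theorem hochschildB_degenerate (n : ℕ) : degenerateChains k A (n + 1)
    ≤ (degenerateChains k A n).comap (hochschildB k A n) := by
  rw [degenerateChains, Submodule.span_le]
  rintro _ ⟨a, ha, rfl⟩
  obtain ⟨i, hi0, hi⟩ : ∃ i, i ≠ 0 ∧ a i = 1 := by
    rcases ha with h | h
    exacts [h, absurd h.1 (Nat.succ_ne_zero n)]
  obtain ⟨i, rfl⟩ := Fin.exists_succ_eq.2 hi0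
  rw [SetLike.mem_coe, Submodule.mem_comap, hochschildB_tprod,
    ← Finset.add_sum_erase _ _ (Finset.mem_univ i.castSucc),
    ← Finset.add_sum_erase _ _ (Finset.mem_erase.2
      ⟨(by simp [Fin.ext_iff] : i.succ ≠ i.castSucc), Finset.mem_univ _⟩),
    ← add_assoc, face_cancel a i hi, ← add_smul]
  have h0 : (-1 : k) ^ (i.castSucc : ℕ) + (-1 : k) ^ (i.succ : ℕ) = 0 := by
    simp [pow_succ]
  rw [h0, zero_smul, zero_add]
  refine Submodule.sum_mem _ fun j hj => Submodule.smul_mem _ _ (Submodule.subset_span ?_)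
  simp only [Finset.mem_erase, Finset.mem_univ, and_true] at hj
  exact ⟨_, Or.inl (face_degenerate a i hi j hj.2 hj.1), rfl⟩

theorem connesB_degenerate (n : ℕ) : degenerateChains k A n
    ≤ (degenerateChains k A (n + 1)).comap (connesB k A n) := by
  rw [degenerateChains, Submodule.span_le]
  rintro _ ⟨a, ha, rfl⟩
  obtain ⟨i, hi⟩ : ∃ i, a i = 1 := by
    rcases ha with ⟨i, _, h⟩ | ⟨_, h⟩
    exacts [⟨i, h⟩, ⟨0, h⟩]
  rw [SetLike.mem_coe, Submodule.mem_comap, connesB_tprod]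
  refine Submodule.sum_mem _ fun j _ => Submodule.smul_mem _ _ (Submodule.subset_span ?_)
  exact ⟨_, Or.inl ⟨(i - j).succ, Fin.succ_ne_zero _, by simp [rotated, hi]⟩, rfl⟩

variable (A)

/-- The Hochschild differential on normalized reduced chains. -/
def reducedHochschildB (n : ℕ) : ReducedChains k A (n + 1) →ₗ[k] ReducedChains k A n :=
  Submodule.mapQ _ _ (hochschildB k A n) (hochschildB_degenerate k n)

/-- Connes' operator on normalized reduced chains. -/
def reducedConnesB (n : ℕ) : ReducedChains k A n →ₗ[k] ReducedChains k A (n + 1) :=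
  Submodule.mapQ _ _ (connesB k A n) (connesB_degenerate k n)

/-- The differential `b + B`, of degree `-1`, on the product total complex of the periodic
`(b, B)`-bicomplex. In total degree `n` this complex is `∏ₚ C_(n-2p)`, `p` being the column; `b`
preserves the column, and `B` maps column `p + 1` to column `p`. -/
def periodicDifferential :
    (ℤ → ∀ m, ReducedChains k A m) →ₗ[k] (ℤ → ∀ m, ReducedChains k A m) :=
  LinearMap.pi fun p => lower (reducedHochschildB k A) ∘ₗ LinearMap.proj p
    + raise (reducedConnesB k A) ∘ₗ LinearMap.proj (p + 1)

/-- Periodic cyclic cycles of degree `n`. -/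
def periodicCycles (n : ℤ) : Submodule k (ℤ → ∀ m, ReducedChains k A m) :=
  hatDegree k (ReducedChains k A) n ⊓ LinearMap.ker (periodicDifferential k A)

/-- Periodic cyclic boundaries of degree `n`. -/
def periodicBoundaries (n : ℤ) : Submodule k (ℤ → ∀ m, ReducedChains k A m) :=
  (hatDegree k (ReducedChains k A) (n + 1)).map (periodicDifferential k A)

/-- The reduced periodic cyclic homology `HPₙ(A)`. -/
abbrev ReducedHP (n : ℤ) : Type _ :=
  periodicCycles k A n ⧸ (periodicBoundaries k A n).submoduleOf (periodicCycles k A n)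

/-- The periodicity map `HPₙ(A) → HPₙ₋₂(A)`, induced by the shift of columns. -/
def periodicity (n m : ℤ) (h : m = n - 2) : ReducedHP k A n →ₗ[k] ReducedHP k A m :=
  Submodule.mapQ _ _
    ((LinearMap.funLeft k (∀ m, ReducedChains k A m) (fun p : ℤ => p + 1)).restrict (by
      rintro x ⟨hx, hx'⟩
      refine ⟨fun p l hl => hx (p + 1) l (by omega), ?_⟩
      rw [SetLike.mem_coe, LinearMap.mem_ker] at hx' ⊢
      ext p : 1
      exact congrFun hx' (p + 1)))
    (by
      rintro ⟨x, hx⟩ ⟨y, hy, rfl⟩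
      exact ⟨fun p => y (p + 1), fun p l hl => hy (p + 1) l (by omega), rfl⟩)

end Cyclic

end NCForms

end

/-!
Multiplication of forms makes `Ω A` act on Hochschild chains (`chainRep`), and acting on the vacuum
`1` identifies reduced `n`-forms `a₀ d a₁ ⋯ d aₙ` with reduced normalized chains `(a₀, …, aₙ)`
(`formsEquivChains`). So `d`, `b`, `B` and `ı_Δ` all act on one graded space. Here
`b (ω d a) = (-1)^|ω| [ω, a]`, and the Karoubi operator `κ = 1 - (b d + d b)` of Cuntz and Quillen is
the signed cyclic rotation `κ (ω d a) = (-1)^|ω| (d a) ω`. Consequently, on `Ωⁿ`,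
`ı_Δ = -b (1 + κ + ⋯ + κⁿ⁻¹)`, `B = (1 + κ + ⋯ + κⁿ) d`, `κⁿ⁺¹ d = d` and `κⁿ = 1 + b κⁿ d`
(`karoubiRelations`).

The rest is linear algebra from these relations. They give `(κⁿ - 1) (κⁿ⁺¹ - 1) = 0` on `Ωⁿ`, and in
characteristic zero the common factor `(κ - 1)²` splits off: the Laplacian `1 - κ = b d + d b` has a
Drazin inverse `G` (`exists_drazin`), which commutes with every operator that commutes with the
Laplacian (`drazin_intertwine`). Let `P = 1 - G (b d + d b)` be the harmonic projection.

* Both `B` and `ı_Δ` vanish on the kernel of `P`. There the two differentials are `b` and `d`, and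
  `G d` and `G b` are contracting homotopies (`toPeriodic_ofPeriodic_sub_mem`,
  `ofPeriodic_toPeriodic_sub_mem`).
* On the image of `P`, in degree `n`, one has `B = (n + 1) d` and `ı_Δ = -n b`, and multiplication
  by `± n!` turns `d + t ı_Δ` into `± (b + B)` (`periodicDifferential_toPeriodic`,
  `formsDifferential_ofPeriodic`). The signs depend only on the form degree, so that the maps commute
  with the shift of powers of `t`.
-/

noncomputable section

namespace NCForms

universe u v

/-! ### The action of forms on chains -/

section Representation

variable {k : Type u} {A : Type v} [Field k] [Ring A] [Algebra k A]

variable (k A) in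
/-- Left multiplication of the leading letter: `(x₀, x₁, …) ↦ (a x₀, x₁, …)`. -/
def chainMul (n : ℕ) : A →ₗ[k] Chains k A n →ₗ[k] Chains k A n :=
  (PiTensorProduct.mapMultilinear k (fun _ : Fin (n + 1) => A) (fun _ => A)).toLinearMap
    (fun _ => LinearMap.id) 0 ∘ₗ LinearMap.mul k A

theorem chainMul_tprod (n : ℕ) (a : A) (x : Fin (n + 1) → A) :
    chainMul k A n a (PiTensorProduct.tprod k x)
      = PiTensorProduct.tprod k (Fin.cons (a * x 0) (Fin.tail x)) := by
  simp only [chainMul, LinearMap.comp_apply, MultilinearMap.toLinearMap_apply,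
    PiTensorProduct.mapMultilinear_apply, PiTensorProduct.map_tprod]
  congr 1
  funext i
  refine Fin.cases ?_ (fun i => ?_) i
  · simp
  · simp [Fin.tail]

variable (k A) in
/-- Prepending a letter: `(x₀, x₁, …) ↦ (a, x₀, x₁, …)`. -/
def chainCons (n : ℕ) : A →ₗ[k] Chains k A n →ₗ[k] Chains k A (n + 1) :=
  PiTensorProduct.lift.toLinearMap ∘ₗ
    (PiTensorProduct.tprod k (s := fun _ : Fin (n + 2) => A)).curryLeft

theorem chainCons_tprod (n : ℕ) (a : A) (x : Fin (n + 1) → A) :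
    chainCons k A n a (PiTensorProduct.tprod k x)
      = PiTensorProduct.tprod k (Fin.cons a x : Fin (n + 2) → A) := by
  simp [chainCons]

variable (k A) in
/-- The operator by which `d a` acts on chains:
`(x₀, x₁, …) ↦ (1, a x₀, x₁, …) - (a, x₀, x₁, …)`, as `d a · x₀ = d (a x₀) - a d x₀`. -/
def chainExact (n : ℕ) : A →ₗ[k] Chains k A n →ₗ[k] Chains k A (n + 1) :=
  LinearMap.llcomp k _ _ _ (chainCons k A n 1) ∘ₗ chainMul k A n - chainCons k A n

theorem chainExact_tprod (n : ℕ) (a : A) (x : Fin (n + 1) → A) :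
    chainExact k A n a (PiTensorProduct.tprod k x)
      = PiTensorProduct.tprod k (Fin.cons 1 (Fin.cons (a * x 0) (Fin.tail x)) : Fin (n + 2) → A)
        - PiTensorProduct.tprod k (Fin.cons a x : Fin (n + 2) → A) := by
  simp [chainExact, chainMul_tprod, chainCons_tprod]

theorem chainMul_one (n : ℕ) : chainMul k A n 1 = LinearMap.id := by
  ext x
  simp [chainMul_tprod, LinearMap.compMultilinearMap_apply]

theorem chainMul_mul (n : ℕ) (a b : A) :
    chainMul k A n (a * b) = chainMul k A n a ∘ₗ chainMul k A n b := by
  ext x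
  simp [chainMul_tprod, LinearMap.compMultilinearMap_apply, mul_assoc]

theorem chainExact_mul (n : ℕ) (a b : A) :
    chainExact k A n (a * b) = chainExact k A n a ∘ₗ chainMul k A n b
      + chainMul k A (n + 1) a ∘ₗ chainExact k A n b := by
  ext x
  simp [chainMul_tprod, chainExact_tprod, LinearMap.compMultilinearMap_apply, mul_assoc]

variable (k A) in
/-- The left regular representation of `Ω A`, on the product of the spaces of Hochschild chains. -/
def chainRep : Omega k A →ₐ[k] Module.End k (∀ m, Chains k A m) :=
  liftForms
    { toFun := fun a => LinearMap.pi fun m => chainMul k A m a ∘ₗ LinearMap.proj m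
      map_add' := fun a b => by ext; simp
      map_smul' := fun c a => by ext; simp }
    { toFun := fun a => raise fun m => chainExact k A m a
      map_add' := fun a b => by
        refine LinearMap.ext fun x => funext fun m => ?_
        cases m <;> simp [raise]
      map_smul' := fun c a => by
        refine LinearMap.ext fun x => funext fun m => ?_
        cases m <;> simp [raise] }
    (by
      refine LinearMap.ext fun x => funext fun m => ?_
      simp [chainMul_one])
    (fun a b => by
      refine LinearMap.ext fun x => funext fun m => ?_
      simp [chainMul_mul])
    (fun a b => by
      refine LinearMap.ext fun x => funext fun m => ?_
      cases m <;> simp [raise, chainExact_mul])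

theorem chainRep_zeroForm (a : A) (x : ∀ m, Chains k A m) (m : ℕ) :
    chainRep k A (zeroForm k a) x m = chainMul k A m a (x m) := by
  rw [chainRep, liftForms_zeroForm]
  rfl

theorem chainRep_exactForm (a : A) (x : ∀ m, Chains k A m) (m : ℕ) :
    chainRep k A (exactForm k a) x (m + 1) = chainExact k A m a (x m) := by
  rw [chainRep, liftForms_exactForm]
  rfl

variable (k A) in
/-- The span of the words with a letter `1` at a place other than the leading one. -/
def unitChains (n : ℕ) : Submodule k (Chains k A n) :=
  Submodule.span k {z | ∃ a : Fin (n + 1) → A, (∃ i, a (Fin.succ i) = 1)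
    ∧ z = PiTensorProduct.tprod k a}

theorem unitChains_le (n : ℕ) : unitChains k A n ≤ degenerateChains k A n :=
  Submodule.span_mono fun _ ⟨a, ⟨i, hi⟩, hz⟩ => ⟨a, Or.inl ⟨_, Fin.succ_ne_zero i, hi⟩, hz⟩

theorem chainMul_unitChains (n : ℕ) (a : A) :
    unitChains k A n ≤ (unitChains k A n).comap (chainMul k A n a) := by
  rw [unitChains, Submodule.span_le]
  rintro _ ⟨x, ⟨i, hi⟩, rfl⟩
  rw [SetLike.mem_coe, Submodule.mem_comap, chainMul_tprod]
  exact Submodule.subset_span ⟨_, ⟨i, by simpa [Fin.tail] using hi⟩, rfl⟩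

theorem chainExact_unitChains (n : ℕ) (a : A) :
    unitChains k A n ≤ (unitChains k A (n + 1)).comap (chainExact k A n a) := by
  rw [unitChains, Submodule.span_le]
  rintro _ ⟨x, ⟨i, hi⟩, rfl⟩
  rw [SetLike.mem_coe, Submodule.mem_comap, chainExact_tprod]
  exact sub_mem (Submodule.subset_span ⟨_, ⟨i.succ, by simpa [Fin.tail] using hi⟩, rfl⟩)
    (Submodule.subset_span ⟨_, ⟨i.succ, by simpa using hi⟩, rfl⟩)

variable (k) in
/-- The product `d a₀ ⋯ d aₙ₋₁` of exact one-forms. -/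
def exactWord {n : ℕ} (a : Fin n → A) : Omega k A :=
  (List.ofFn fun i => exactForm k (a i)).prod

theorem exactWord_zero (a : Fin 0 → A) : exactWord k a = 1 := by simp [exactWord]

theorem exactWord_succ {n : ℕ} (a : Fin (n + 1) → A) :
    exactWord k a = exactForm k (a 0) * exactWord k (Fin.tail a) := by
  simp [exactWord, List.ofFn_succ, Fin.tail]

theorem exactWord_last {n : ℕ} (a : Fin (n + 1) → A) :
    exactWord k a = exactWord k (Fin.init a) * exactForm k (a (Fin.last n)) := by
  rw [exactWord, List.ofFn_succ', List.concat_eq_append, List.prod_append, List.prod_singleton]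
  rfl

theorem exactForm_one : exactForm k (1 : A) = 0 := by
  simpa [zeroForm_one] using exactForm_mul k (1 : A) 1

theorem exactWord_eq_zero {n : ℕ} (a : Fin n → A) (i : Fin n) (hi : a i = 1) :
    exactWord k a = 0 := by
  refine List.prod_eq_zero ((List.mem_ofFn' _ _).2 ⟨i, ?_⟩)
  simp only [hi, exactForm_one]

variable (k) in
/-- The form `a₀ d a₁ ⋯ d aₙ`. -/
def formWord {n : ℕ} (a : Fin (n + 1) → A) : Omega k A :=
  zeroForm k (a 0) * exactWord k (Fin.tail a)

theorem exactWord_mem {n : ℕ} (a : Fin n → A) :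
    exactWord k a ∈ LinearMap.range (exactForm k (A := A)) ^ n := by
  induction n with
  | zero => rw [exactWord_zero, pow_zero]; exact Submodule.one_le.1 le_rfl
  | succ n ih =>
    rw [exactWord_succ, pow_succ']
    exact Submodule.mul_mem_mul ⟨_, rfl⟩ (ih _)

theorem formWord_mem {n : ℕ} (a : Fin (n + 1) → A) : formWord k a ∈ formsOfDegree k A n :=
  Submodule.mul_mem_mul ⟨_, rfl⟩ (exactWord_mem _)

theorem range_eq_span (f : A →ₗ[k] Omega k A) :
    LinearMap.range f = Submodule.span k (Set.range f) := by
  rw [← LinearMap.coe_range, Submodule.span_eq]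

theorem exact_pow_eq_span (n : ℕ) : LinearMap.range (exactForm k (A := A)) ^ n
    = Submodule.span k (Set.range fun a : Fin n → A => exactWord k a) := by
  induction n with
  | zero =>
    rw [pow_zero, Submodule.one_eq_span]
    congr 1
    ext x
    simp [exactWord_zero]
  | succ n ih =>
    rw [pow_succ', ih, range_eq_span, Submodule.span_mul_span]
    congr 1
    ext x
    constructor
    · rintro ⟨_, ⟨a, rfl⟩, _, ⟨x, rfl⟩, rfl⟩
      exact ⟨Fin.cons a x, by simp [exactWord_succ]⟩
    · rintro ⟨a, rfl⟩
      exact ⟨_, ⟨a 0, rfl⟩, _, ⟨Fin.tail a, rfl⟩, (exactWord_succ a).symm⟩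

theorem formsOfDegree_eq_span (n : ℕ) : formsOfDegree k A n
    = Submodule.span k (Set.range fun a : Fin (n + 1) → A => formWord k a) := by
  rw [formsOfDegree, exact_pow_eq_span, range_eq_span, Submodule.span_mul_span]
  congr 1
  ext x
  constructor
  · rintro ⟨_, ⟨a, rfl⟩, _, ⟨x, rfl⟩, rfl⟩
    exact ⟨Fin.cons a x, by simp [formWord]⟩
  · rintro ⟨a, rfl⟩
    exact ⟨_, ⟨a 0, rfl⟩, _, ⟨Fin.tail a, rfl⟩, rfl⟩

/-- The form `d a₀ ⋯ d aₙ₋₁` acts on the vacuum `1` by creating the chain `(1, a₀, …, aₙ₋₁)`, up to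
words with a letter `1`. -/
theorem chainRep_exactWord {n : ℕ} (a : Fin n → A) :
    chainRep k A (exactWord k a) (Pi.single 0 (PiTensorProduct.tprod k fun _ => 1)) n
      - PiTensorProduct.tprod k (Fin.cons 1 a : Fin (n + 1) → A) ∈ unitChains k A n := by
  induction n with
  | zero =>
    have h : (Fin.cons 1 a : Fin 1 → A) = fun _ => 1 := by
      funext i
      fin_cases i
      rfl
    simp [exactWord_zero, h]
  | succ n ih =>
    rw [exactWord_succ, map_mul, Module.End.mul_apply, chainRep_exactForm]
    have h := chainExact_unitChains n (a 0) (ih (Fin.tail a))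
    rw [Submodule.mem_comap, map_sub, chainExact_tprod] at h
    have h2 : PiTensorProduct.tprod k (Fin.cons (a 0) (Fin.cons 1 (Fin.tail a)) : Fin (n + 2) → A)
        ∈ unitChains k A (n + 1) := Submodule.subset_span ⟨_, ⟨0, by simp⟩, rfl⟩
    have h3 := sub_mem h h2
    simp only [Fin.cons_zero, Fin.tail_cons, mul_one, Fin.cons_self_tail] at h3
    convert h3 using 1
    abel

variable (k A) in
/-- The quotient map onto reduced chains. -/
def toReducedChains (n : ℕ) : Chains k A n →ₗ[k] ReducedChains k A n :=
  (degenerateChains k A n).mkQ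

variable (k A) in
/-- The quotient map onto reduced forms. -/
def toReducedForms (n : ℕ) : formsOfDegree k A n →ₗ[k] ReducedForms k A n :=
  (scalarForms k A n).mkQ

variable (k A) in
/-- The class in the reduced chains of the degree `n` component of a form. It is only relevant for
forms of degree `n`, where it is the map `a₀ d a₁ ⋯ d aₙ ↦ (a₀, …, aₙ)`. -/
def formClass (n : ℕ) : Omega k A →ₗ[k] ReducedChains k A n :=
  toReducedChains k A n ∘ₗ LinearMap.proj n ∘ₗ
    LinearMap.applyₗ (R := k) (M := ∀ m, Chains k A m)
      (Pi.single 0 (PiTensorProduct.tprod k fun _ => 1)) ∘ₗ (chainRep k A).toLinearMap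

variable (k) in
/-- The class of the word `(a₀, …, aₙ)` in the reduced chains. -/
def chainWord {n : ℕ} (a : Fin (n + 1) → A) : ReducedChains k A n :=
  toReducedChains k A n (PiTensorProduct.tprod k a)

theorem formClass_formWord {n : ℕ} (a : Fin (n + 1) → A) :
    formClass k A n (formWord k a) = chainWord k a := by
  have h := unitChains_le n (chainMul_unitChains (k := k) n (a 0) (chainRep_exactWord (Fin.tail a)))
  rw [map_sub, chainMul_tprod] at h
  simp only [Fin.cons_zero, Fin.tail_cons, mul_one, Fin.cons_self_tail] at h
  change Submodule.Quotient.mk _ = Submodule.Quotient.mk _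
  rw [Submodule.Quotient.eq]
  change chainRep k A (formWord k a) _ n - _ ∈ _
  rwa [formWord, map_mul, Module.End.mul_apply, chainRep_zeroForm]

theorem toReducedChains_surjective (n : ℕ) : Function.Surjective (toReducedChains k A n) :=
  Submodule.mkQ_surjective _

theorem chainWord_span (n : ℕ) :
    Submodule.span k (Set.range fun a : Fin (n + 1) → A => chainWord k a) = ⊤ := by
  have h : (Set.range fun a : Fin (n + 1) → A => chainWord k a)
      = toReducedChains k A n '' Set.range (PiTensorProduct.tprod k) := by
    rw [← Set.range_comp]
    rfl
  rw [h, ← Submodule.map_span, PiTensorProduct.span_tprod_eq_top, Submodule.map_top,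
    LinearMap.range_eq_top.2 (toReducedChains_surjective n)]

/-- Linear maps on reduced chains agree if they agree on the classes of forms `a₀ d a₁ ⋯ d aₙ`. -/
theorem reducedChains_ext {n : ℕ} {N : Type*} [AddCommGroup N] [Module k N]
    {f g : ReducedChains k A n →ₗ[k] N}
    (h : ∀ a y, y ∈ LinearMap.range (exactForm k (A := A)) ^ n →
      f (formClass k A n (zeroForm k a * y)) = g (formClass k A n (zeroForm k a * y))) : f = g := by
  refine LinearMap.ext_on_range (chainWord_span n) fun a => ?_
  rw [← formClass_formWord]
  exact h _ _ (exactWord_mem _)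

/-! ### Reduced forms and reduced chains -/

variable (k A) in
/-- The form `a₀ d a₁ ⋯ d aₙ` as a multilinear map of `(a₀, …, aₙ)`. -/
def formMultilinear (n : ℕ) : MultilinearMap k (fun _ : Fin (n + 1) => A) (Omega k A) :=
  (MultilinearMap.mkPiAlgebraFin k (n + 1) (Omega k A)).compLinearMap
    (Fin.cons (zeroForm k) fun _ => exactForm k)

theorem formMultilinear_apply {n : ℕ} (a : Fin (n + 1) → A) :
    formMultilinear k A n a = formWord k a := by
  simp [formMultilinear, formWord, exactWord, List.ofFn_succ, Fin.tail]

variable (k A) in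
/-- The map `(a₀, …, aₙ) ↦ a₀ d a₁ ⋯ d aₙ` from chains to forms. -/
def chainsToForms (n : ℕ) : Chains k A n →ₗ[k] formsOfDegree k A n :=
  (PiTensorProduct.lift (formMultilinear k A n)).codRestrict _ fun x => by
    induction x using PiTensorProduct.induction_on with
    | smul_tprod r a =>
      rw [map_smul, PiTensorProduct.lift.tprod, formMultilinear_apply]
      exact Submodule.smul_mem _ _ (formWord_mem a)
    | add x y hx hy => rw [map_add]; exact add_mem hx hy

theorem chainsToForms_tprod {n : ℕ} (a : Fin (n + 1) → A) :
    chainsToForms k A n (PiTensorProduct.tprod k a) = ⟨formWord k a, formWord_mem a⟩ := by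
  apply Subtype.ext
  simp [chainsToForms, formMultilinear_apply]

theorem chainsToForms_degenerate (n : ℕ) :
    degenerateChains k A n ≤ (scalarForms k A n).comap (chainsToForms k A n) := by
  rw [degenerateChains, Submodule.span_le]
  rintro _ ⟨a, h, rfl⟩
  rw [SetLike.mem_coe, Submodule.mem_comap, chainsToForms_tprod]
  rcases h with ⟨i, hi, h⟩ | ⟨rfl, h⟩
  · obtain ⟨i, rfl⟩ := Fin.exists_succ_eq.2 hi
    have h0 : formWord k a = 0 := by
      rw [formWord, exactWord_eq_zero (Fin.tail a) i h, mul_zero]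
    have h1 : (⟨formWord k a, formWord_mem a⟩ : formsOfDegree k A n) = 0 := Subtype.ext h0
    rw [h1]
    exact Submodule.zero_mem _
  · change formWord k a ∈ (1 : Submodule k (Omega k A))
    rw [formWord, exactWord_zero, h, zeroForm_one, mul_one]
    exact Submodule.one_le.1 le_rfl

theorem formClass_scalarForms (n : ℕ) :
    scalarForms k A n ≤ LinearMap.ker (formClass k A n ∘ₗ (formsOfDegree k A n).subtype) := by
  cases n with
  | zero =>
    rintro ⟨x, hx⟩ h
    obtain ⟨r, hr⟩ := Submodule.mem_one.1 h
    have h1 : formClass k A 0 1 = 0 := by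
      have h2 := formClass_formWord (k := k) (fun _ : Fin 1 => (1 : A))
      rw [formWord, exactWord_zero, zeroForm_one, mul_one] at h2
      rw [h2]
      exact (Submodule.Quotient.mk_eq_zero _).2
        (Submodule.subset_span ⟨_, Or.inr ⟨rfl, rfl⟩, rfl⟩)
    rw [LinearMap.mem_ker, LinearMap.comp_apply, ← hr,
      Algebra.algebraMap_eq_smul_one, map_smul, h1, smul_zero]
  | succ n => exact bot_le

theorem chainsToForms_surjective (n : ℕ) : Function.Surjective (chainsToForms k A n) := by
  rintro ⟨x, hx⟩
  have h : formsOfDegree k A n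
      ≤ LinearMap.range (PiTensorProduct.lift (formMultilinear k A n)) := by
    rw [formsOfDegree_eq_span, Submodule.span_le]
    rintro _ ⟨a, rfl⟩
    exact ⟨PiTensorProduct.tprod k a, by simp [formMultilinear_apply]⟩
  obtain ⟨c, hc⟩ := h hx
  exact ⟨c, Subtype.ext hc⟩

variable (k A) in
/-- The map `(a₀, …, aₙ) ↦ a₀ d a₁ ⋯ d aₙ` from reduced chains to reduced forms. -/
def reducedChainsToForms (n : ℕ) : ReducedChains k A n →ₗ[k] ReducedForms k A n :=
  Submodule.mapQ _ _ (chainsToForms k A n) (chainsToForms_degenerate n)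

variable (k A) in
/-- The map `a₀ d a₁ ⋯ d aₙ ↦ (a₀, …, aₙ)` from reduced forms to reduced chains. -/
def reducedFormsToChains (n : ℕ) : ReducedForms k A n →ₗ[k] ReducedChains k A n :=
  (scalarForms k A n).liftQ (formClass k A n ∘ₗ (formsOfDegree k A n).subtype)
    (formClass_scalarForms n)

theorem reducedFormsToChains_comp (n : ℕ) :
    reducedFormsToChains k A n ∘ₗ reducedChainsToForms k A n = LinearMap.id := by
  refine LinearMap.ext_on_range (chainWord_span n) fun a => ?_
  change formClass k A n (chainsToForms k A n (PiTensorProduct.tprod k a)) = _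
  rw [chainsToForms_tprod]
  exact formClass_formWord a

theorem reducedChainsToForms_surjective (n : ℕ) :
    Function.Surjective (reducedChainsToForms k A n) := by
  intro y
  obtain ⟨x, rfl⟩ := Submodule.mkQ_surjective _ y
  obtain ⟨c, rfl⟩ := chainsToForms_surjective n x
  exact ⟨toReducedChains k A n c, rfl⟩

variable (k A) in
/-- The isomorphism `a₀ d a₁ ⋯ d aₙ ↔ (a₀, …, aₙ)` of reduced forms with reduced chains. -/
def formsEquivChains (n : ℕ) : ReducedForms k A n ≃ₗ[k] ReducedChains k A n :=
  LinearEquiv.ofLinearMap (reducedFormsToChains k A n) (reducedChainsToForms k A n)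
    (reducedFormsToChains_comp n) (by
      refine LinearMap.ext fun y => ?_
      obtain ⟨c, rfl⟩ := reducedChainsToForms_surjective n y
      exact congrArg _ (LinearMap.congr_fun (reducedFormsToChains_comp n) c))

theorem formsEquivChains_apply {n : ℕ} (x : formsOfDegree k A n) :
    formsEquivChains k A n (toReducedForms k A n x) = formClass k A n x := rfl

end Representation

/-! ### Drazin inverses and the Karoubi operator -/

section Drazin

open Polynomial in
/-- If `S = 1 - T` satisfies `(Sⁿ - 1) (Sⁿ⁺¹ - 1) = 0` with `n > 0`, then `T` has a Drazin inverse
`G` of index at most two: the common divisor `T²` of `Sⁿ - 1` and `Sⁿ⁺¹ - 1` is split off, and the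
complementary factor is `n (n + 1)` modulo `T`, hence a unit modulo powers of `T`. -/
theorem exists_drazin {k R : Type*} [Field k] [CharZero k] [Ring R] [Algebra k R] (T : R) (n : ℕ)
    (hn : n ≠ 0) (h : ((1 - T) ^ n - 1) * ((1 - T) ^ (n + 1) - 1) = 0) :
    ∃ G : R, Commute T G ∧ T * G * G = G ∧ T ^ 2 * (T * G) = T ^ 2 := by
  have key : ∀ m : ℕ, ∃ v : k[X], (1 - X) ^ m = 1 - C (m : k) * X + X ^ 2 * v := by
    intro m
    induction m with
    | zero => exact ⟨0, by simp⟩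
    | succ m ih =>
      obtain ⟨v, hv⟩ := ih
      refine ⟨C (m : k) + v - X * v, ?_⟩
      rw [pow_succ, hv]
      push_cast
      rw [map_add, map_one]
      ring
  obtain ⟨v, hv⟩ := key n
  obtain ⟨v', hv'⟩ := key (n + 1)
  have hc : (n : k) * ((n + 1 : ℕ) : k) ≠ 0 :=
    mul_ne_zero (Nat.cast_ne_zero.2 hn) (Nat.cast_ne_zero.2 n.succ_ne_zero)
  set w : k[X] := C ((n : k) * ((n + 1 : ℕ) : k))⁻¹
    * (C (n : k) * v' + C ((n + 1 : ℕ) : k) * v - X * v * v') with hw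
  have hpoly : X ^ 2 - X ^ 3 * w = C ((n : k) * ((n + 1 : ℕ) : k))⁻¹
      * (((1 - X) ^ n - 1) * ((1 - X) ^ (n + 1) - 1)) := by
    have h1 : C ((n : k) * ((n + 1 : ℕ) : k))⁻¹ * (C (n : k) * C ((n + 1 : ℕ) : k)) = 1 := by
      rw [← C_mul, ← C_mul, inv_mul_cancel₀ hc, C_1]
    rw [hv, hv', hw]
    linear_combination (-X ^ 2) * h1
  have h23 : T ^ 2 = T ^ 3 * aeval T w := by
    have := congrArg (aeval T) hpoly
    simp only [map_sub, map_mul, map_pow, aeval_X, map_one, h, mul_zero] at this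
    exact sub_eq_zero.1 this
  have hcomm : Commute T (aeval T w) := by
    have := (Commute.all X w).map (aeval T)
    rwa [aeval_X] at this
  generalize aeval T w = W at h23 hcomm
  have hTW : T * W = W * T := hcomm
  -- everything takes place in the commutative ring generated by `T` and `W`
  have hp (i j : ℕ) : Commute (T ^ i) (W ^ j) := (hcomm.pow_left i).pow_right j
  have red (i j : ℕ) : T ^ (i + 3) * W ^ (j + 1) = T ^ (i + 2) * W ^ j := by
    rw [pow_add T i 2, h23, pow_succ' W, ← mul_assoc, ← mul_assoc, ← pow_add]
  refine ⟨T ^ 3 * W ^ 4, ?_, ?_, ?_⟩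
  · exact ((Commute.refl T).pow_right 3).mul_right (hcomm.pow_right 4)
  · calc T * (T ^ 3 * W ^ 4) * (T ^ 3 * W ^ 4)
        = T * T ^ 3 * (W ^ 4 * T ^ 3) * W ^ 4 := by simp only [mul_assoc]
      _ = T ^ 7 * W ^ 8 := by
          rw [← (hp 3 4).eq, ← pow_succ', ← mul_assoc, ← pow_add, mul_assoc, ← pow_add]
      _ = T ^ 3 * W ^ 4 := by rw [red 4 7, red 3 6, red 2 5, red 1 4]
  · rw [← mul_assoc, ← mul_assoc, ← pow_succ, ← pow_add, red 3 3, red 2 2, red 1 1, red 0 0]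
    simp

/-- The Drazin inverse is natural: an operator which intertwines `T` and `T'` intertwines their
Drazin inverses. -/
theorem drazin_intertwine {k M N : Type*} [Field k] [AddCommGroup M] [Module k M] [AddCommGroup N]
    [Module k N] {T G : Module.End k M} {T' G' : Module.End k N} (hTG : Commute T G)
    (hG : T * G * G = G) (hT : T ^ 2 * (T * G) = T ^ 2) (hTG' : Commute T' G')
    (hG' : T' * G' * G' = G') (hT' : T' ^ 2 * (T' * G') = T' ^ 2) (f : M →ₗ[k] N)
    (hf : ∀ x, T' (f x) = f (T x)) (x : M) : G' (f x) = f (G x) := by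
  have e1 (x : M) : T (G x) = G (T x) := LinearMap.congr_fun hTG x
  have e1' (x : N) : T' (G' x) = G' (T' x) := LinearMap.congr_fun hTG' x
  have e2 (x : M) : T (G (G x)) = G x := LinearMap.congr_fun hG x
  have e2' (x : N) : T' (G' (G' x)) = G' x := LinearMap.congr_fun hG' x
  have e3 (x : M) : T (T (T (G x))) = T (T x) := LinearMap.congr_fun hT x
  have e3' (x : N) : T' (T' (T' (G' x))) = T' (T' x) := LinearMap.congr_fun hT' x
  -- the projections `T G` and `T' G'` are intertwined
  have q1 (x : M) : T' (G' (f (T (G x)))) = f (T (G x)) := by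
    have : f (T (G x)) = T' (T' (f (G (G x)))) := by rw [hf, hf, e2]
    rw [this, ← e1', ← e1', e3']
  have r (x : M) : T' (G' (f x)) = G' (G' (f (T (T x)))) := by
    rw [← hf, ← hf, ← e1' (T' (f x)), ← e1' (G' (T' (f x))), ← e1' (f x), ← e1' (G' (f x)), e2']
  have q2 (x : M) : T' (G' (f (T (G x)))) = T' (G' (f x)) := by rw [r, r x, e3]
  have q (x : M) : T' (G' (f x)) = f (T (G x)) := by rw [← q2, q1]
  calc G' (f x) = G' (f (T (G x))) := by rw [← q, ← e1', e2']
    _ = f (G x) := by rw [← hf, ← e1', q, e2]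

end Drazin

section Laplacian

variable {k : Type*} [Field k] {C : ℕ → Type*} [∀ n, AddCommGroup (C n)] [∀ n, Module k (C n)]
variable (d : ∀ n, C n →ₗ[k] C (n + 1)) (b : ∀ n, C (n + 1) →ₗ[k] C n)

/-- The Laplacian `b d + d b` of Cuntz and Quillen. -/
def laplacian : ∀ n, Module.End k (C n)
  | 0 => b 0 ∘ₗ d 0
  | n + 1 => b (n + 1) ∘ₗ d (n + 1) + d n ∘ₗ b n

/-- The Karoubi operator `κ = 1 - (b d + d b)`. -/
def karoubi (n : ℕ) : Module.End k (C n) := 1 - laplacian d b n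

/-- The relations between the de Rham differential `d`, the Hochschild differential `b`, the reduced
contraction `c` and Connes' operator `B` on noncommutative forms, in terms of the Karoubi
operator. -/
structure KaroubiRelations (c : ∀ n, C (n + 1) →ₗ[k] C n) (B : ∀ n, C n →ₗ[k] C (n + 1)) :
    Prop where
  d_d : ∀ n x, d (n + 1) (d n x) = 0
  b_b : ∀ n x, b n (b (n + 1) x) = 0
  karoubi_pow_d : ∀ n x, (karoubi d b (n + 1) ^ (n + 1)) (d n x) = d n x
  karoubi_pow : ∀ n x, (karoubi d b n ^ n) x = x + b n ((karoubi d b (n + 1) ^ n) (d n x))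
  contraction : ∀ n x, c n x = -b n ((∑ i ∈ Finset.range (n + 1), karoubi d b (n + 1) ^ i) x)
  connes : ∀ n x, B n x = (∑ i ∈ Finset.range (n + 1), karoubi d b (n + 1) ^ i) (d n x)

theorem pow_intertwine {M N : Type*} [AddCommGroup M] [Module k M] [AddCommGroup N] [Module k N]
    {S : Module.End k M} {S' : Module.End k N} {f : M →ₗ[k] N} (h : ∀ x, S' (f x) = f (S x))
    (i : ℕ) (x : M) : (S' ^ i) (f x) = f ((S ^ i) x) := by
  induction i generalizing x with
  | zero => simp
  | succ i ih => rw [pow_succ, pow_succ, Module.End.mul_apply, Module.End.mul_apply, h, ih]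

theorem one_sub_pow_apply {M : Type*} [AddCommGroup M] [Module k M] {T : Module.End k M} {x : M}
    (h : T (T x) = 0) (n : ℕ) : ((1 - T) ^ n) x = x - (n : k) • T x := by
  induction n with
  | zero => simp
  | succ n ih =>
    rw [pow_succ', Module.End.mul_apply, ih]
    simp [h, add_smul]
    abel

/-- In characteristic zero, a unipotent operator `1 - T` with `T² x = 0` which has a power fixing `x`
fixes `x`. -/
theorem apply_eq_zero_of_pow [CharZero k] {M : Type*} [AddCommGroup M] [Module k M]
    {T : Module.End k M} {x : M} (h : T (T x) = 0) (n : ℕ) (hn : n ≠ 0)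
    (h' : ((1 - T) ^ n) x = x) : T x = 0 := by
  rw [one_sub_pow_apply h, sub_eq_self] at h'
  exact (smul_eq_zero.1 h').resolve_left (Nat.cast_ne_zero.2 hn)

theorem laplacian_eq (n : ℕ) : laplacian d b n = 1 - karoubi d b n := by simp [karoubi]

theorem laplacian_geom (n m : ℕ) (x : C n) :
    laplacian d b n ((∑ i ∈ Finset.range m, karoubi d b n ^ i) x)
      = x - (karoubi d b n ^ m) x := by
  rw [laplacian_eq, ← Module.End.mul_apply, mul_neg_geom_sum]
  rfl

theorem geom_laplacian (n m : ℕ) (x : C n) :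
    (∑ i ∈ Finset.range m, karoubi d b n ^ i) (laplacian d b n x)
      = x - (karoubi d b n ^ m) x := by
  rw [laplacian_eq, ← Module.End.mul_apply, geom_sum_mul_neg]
  rfl

theorem geom_of_laplacian (n m : ℕ) {x : C n} (hx : laplacian d b n x = 0) :
    (∑ i ∈ Finset.range m, karoubi d b n ^ i) x = (m : k) • x := by
  have hp (i : ℕ) : (karoubi d b n ^ i) x = x := by
    have := one_sub_pow_apply (T := laplacian d b n) (x := x) (by rw [hx, map_zero]) i
    rwa [hx, smul_zero, sub_zero] at this
  simp [LinearMap.sum_apply, hp, Nat.cast_smul_eq_nsmul]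

namespace KaroubiRelations

variable {d b} {c : ∀ n, C (n + 1) →ₗ[k] C n} {B : ∀ n, C n →ₗ[k] C (n + 1)}
variable (h : KaroubiRelations d b c B)

include h

theorem laplacian_d (n : ℕ) (x : C n) :
    laplacian d b (n + 1) (d n x) = d n (laplacian d b n x) := by
  cases n <;> simp [laplacian, h.d_d]

theorem laplacian_b (n : ℕ) (x : C (n + 1)) :
    laplacian d b n (b n x) = b n (laplacian d b (n + 1) x) := by
  cases n <;> simp [laplacian, h.b_b]

theorem karoubi_d (n : ℕ) (x : C n) : karoubi d b (n + 1) (d n x) = d n (karoubi d b n x) := by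
  simp [karoubi, h.laplacian_d]

theorem karoubi_b (n : ℕ) (x : C (n + 1)) :
    karoubi d b n (b n x) = b n (karoubi d b (n + 1) x) := by
  simp [karoubi, h.laplacian_b]

theorem b_karoubi_pow (n : ℕ) (x : C (n + 1)) :
    b n ((karoubi d b (n + 1) ^ (n + 1)) x) = b n x := by
  rw [h.karoubi_pow, map_add, h.b_b, add_zero]

theorem laplacian_connes (n : ℕ) (x : C n) : laplacian d b (n + 1) (B n x) = 0 := by
  rw [h.connes, laplacian_geom, h.karoubi_pow_d, sub_self]

theorem connes_laplacian (n : ℕ) (x : C n) : B n (laplacian d b n x) = 0 := by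
  rw [h.connes, ← h.laplacian_d, geom_laplacian, h.karoubi_pow_d, sub_self]

theorem laplacian_contraction (n : ℕ) (x : C (n + 1)) : laplacian d b n (c n x) = 0 := by
  rw [h.contraction, map_neg, h.laplacian_b, laplacian_geom, map_sub, h.b_karoubi_pow, sub_self,
    neg_zero]

theorem contraction_laplacian (n : ℕ) (x : C (n + 1)) :
    c n (laplacian d b (n + 1) x) = 0 := by
  rw [h.contraction, geom_laplacian, map_sub, h.b_karoubi_pow, sub_self, neg_zero]

theorem geom_d (n m : ℕ) (x : C n) : (∑ i ∈ Finset.range m, karoubi d b (n + 1) ^ i) (d n x)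
    = d n ((∑ i ∈ Finset.range m, karoubi d b n ^ i) x) := by
  simp only [LinearMap.sum_apply, map_sum, pow_intertwine (h.karoubi_d n)]

theorem geom_b (n m : ℕ) (x : C (n + 1)) : (∑ i ∈ Finset.range m, karoubi d b n ^ i) (b n x)
    = b n ((∑ i ∈ Finset.range m, karoubi d b (n + 1) ^ i) x) := by
  simp only [LinearMap.sum_apply, map_sum, pow_intertwine (h.karoubi_b n)]

theorem connes_d (n : ℕ) (x : C n) : B (n + 1) (d n x) = 0 := by
  rw [h.connes, h.d_d, map_zero]

theorem contraction_b (n : ℕ) (x : C (n + 2)) : c n (b (n + 1) x) = 0 := by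
  rw [h.contraction, h.geom_b, h.b_b, neg_zero]

theorem d_connes (n : ℕ) (x : C n) : d (n + 1) (B n x) = 0 := by
  rw [h.connes, ← h.geom_d, h.d_d, map_zero]

theorem b_contraction (n : ℕ) (x : C (n + 2)) : b n (c (n + 1) x) = 0 := by
  rw [h.contraction, map_neg, h.b_b, neg_zero]

theorem exists_green [CharZero k] (n : ℕ) : ∃ G : Module.End k (C n),
    Commute (laplacian d b n) G ∧ laplacian d b n * G * G = G
      ∧ laplacian d b n ^ 2 * (laplacian d b n * G) = laplacian d b n ^ 2 := by
  rcases Nat.eq_zero_or_pos n with rfl | hn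
  · -- on zero-forms the Laplacian vanishes
    have h0 : laplacian d b 0 = 0 := LinearMap.ext fun x => by
      have := h.karoubi_pow 0 x
      simp only [pow_zero, Module.End.one_apply, left_eq_add] at this
      exact this
    exact ⟨0, by simp [h0], by simp, by simp [h0]⟩
  · refine exists_drazin (k := k) _ n hn.ne' (LinearMap.ext fun x => ?_)
    have h1 : 1 - laplacian d b n = karoubi d b n := rfl
    rw [h1]
    simp only [Module.End.mul_apply, LinearMap.sub_apply, Module.End.one_apply,
      LinearMap.zero_apply, map_sub]
    rw [h.karoubi_pow, h.karoubi_pow n x, ← pow_intertwine (h.karoubi_d n), h.karoubi_pow_d]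
    abel

/-- The Green operator `G`, the Drazin inverse of the Laplacian. It is unique, although this is not
needed beyond its naturality `drazin_intertwine`. -/
def green [CharZero k] (n : ℕ) : Module.End k (C n) := (h.exists_green n).choose

variable [CharZero k]

theorem laplacian_green (n : ℕ) (x : C n) :
    laplacian d b n (h.green n x) = h.green n (laplacian d b n x) :=
  LinearMap.congr_fun (h.exists_green n).choose_spec.1 x

theorem laplacian_green_green (n : ℕ) (x : C n) :
    laplacian d b n (h.green n (h.green n x)) = h.green n x :=
  LinearMap.congr_fun (h.exists_green n).choose_spec.2.1 x

theorem laplacian_sq_green (n : ℕ) (x : C n) :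
    laplacian d b n (laplacian d b n (laplacian d b n (h.green n x)))
      = laplacian d b n (laplacian d b n x) :=
  LinearMap.congr_fun (h.exists_green n).choose_spec.2.2 x

theorem green_d (n : ℕ) (x : C n) : h.green (n + 1) (d n x) = d n (h.green n x) :=
  have s := (h.exists_green n).choose_spec
  have s' := (h.exists_green (n + 1)).choose_spec
  drazin_intertwine s.1 s.2.1 s.2.2 s'.1 s'.2.1 s'.2.2 (d n) (h.laplacian_d n) x

theorem green_b (n : ℕ) (x : C (n + 1)) : h.green n (b n x) = b n (h.green (n + 1) x) :=
  have s := (h.exists_green n).choose_spec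
  have s' := (h.exists_green (n + 1)).choose_spec
  drazin_intertwine s'.1 s'.2.1 s'.2.2 s.1 s.2.1 s.2.2 (b n) (h.laplacian_b n) x

/-- The harmonic projection `P = 1 - G (b d + d b)`, onto the generalized eigenspace of the Karoubi
operator for the eigenvalue `1`. -/
def harmonic (n : ℕ) : Module.End k (C n) := 1 - laplacian d b n * h.green n

theorem harmonic_apply (n : ℕ) (x : C n) :
    h.harmonic n x = x - laplacian d b n (h.green n x) := rfl

theorem harmonic_harmonic (n : ℕ) (x : C n) : h.harmonic n (h.harmonic n x) = h.harmonic n x := by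
  simp only [harmonic_apply, map_sub]
  rw [← h.laplacian_green, h.laplacian_green_green]
  simp

theorem harmonic_d (n : ℕ) (x : C n) : h.harmonic (n + 1) (d n x) = d n (h.harmonic n x) := by
  simp only [harmonic_apply, map_sub, h.green_d, h.laplacian_d]

theorem harmonic_b (n : ℕ) (x : C (n + 1)) : h.harmonic n (b n x) = b n (h.harmonic (n + 1) x) := by
  simp only [harmonic_apply, map_sub, h.green_b, h.laplacian_b]

theorem laplacian_sq_harmonic (n : ℕ) (x : C n) :
    laplacian d b n (laplacian d b n (h.harmonic n x)) = 0 := by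
  simp only [harmonic_apply, map_sub, h.laplacian_sq_green, sub_self]

/-- The Laplacian is nilpotent on harmonic elements, but it vanishes on exact harmonic elements, as
these are fixed by a power of the Karoubi operator. -/
theorem laplacian_d_harmonic (n : ℕ) (x : C n) :
    laplacian d b (n + 1) (d n (h.harmonic n x)) = 0 := by
  refine apply_eq_zero_of_pow ?_ (n + 1) n.succ_ne_zero (h.karoubi_pow_d n _)
  rw [h.laplacian_d, h.laplacian_d, h.laplacian_sq_harmonic, map_zero]

theorem laplacian_b_harmonic (n : ℕ) (x : C (n + 1)) :
    laplacian d b n (b n (h.harmonic (n + 1) x)) = 0 := by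
  refine apply_eq_zero_of_pow ?_ (n + 1) n.succ_ne_zero ?_
  · rw [h.laplacian_b, h.laplacian_b, h.laplacian_sq_harmonic, map_zero]
  · exact (pow_intertwine (h.karoubi_b n) (n + 1) _).trans (h.b_karoubi_pow n _)

theorem connes_harmonic (n : ℕ) (x : C n) : B n (h.harmonic n x) = B n x := by
  rw [harmonic_apply, map_sub, h.connes_laplacian, sub_zero]

theorem harmonic_connes (n : ℕ) (x : C n) : h.harmonic (n + 1) (B n x) = B n x := by
  rw [harmonic_apply, h.laplacian_green, h.laplacian_connes, map_zero, sub_zero]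

theorem contraction_harmonic (n : ℕ) (x : C (n + 1)) : c n (h.harmonic (n + 1) x) = c n x := by
  rw [harmonic_apply, map_sub, h.contraction_laplacian, sub_zero]

theorem harmonic_contraction (n : ℕ) (x : C (n + 1)) : h.harmonic n (c n x) = c n x := by
  rw [harmonic_apply, h.laplacian_green, h.laplacian_contraction, map_zero, sub_zero]

/-- On harmonic elements of degree `n`, Connes' operator is `(n + 1) d`. -/
theorem connes_eq (n : ℕ) (x : C n) : B n x = ((n + 1 : ℕ) : k) • d n (h.harmonic n x) := by
  rw [← h.connes_harmonic, h.connes, geom_of_laplacian _ _ _ _ (h.laplacian_d_harmonic n x)]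

/-- On harmonic elements of degree `n + 1`, the reduced contraction is `-(n + 1) b`. -/
theorem contraction_eq (n : ℕ) (x : C (n + 1)) :
    c n x = -((n + 1 : ℕ) : k) • b n (h.harmonic (n + 1) x) := by
  rw [← h.contraction_harmonic, h.contraction, ← h.geom_b,
    geom_of_laplacian _ _ _ _ (h.laplacian_b_harmonic n x), neg_smul]


end KaroubiRelations
end Laplacian

/-! ### The Karoubi operator on forms -/

section Words

variable {k : Type u} {A : Type v} [Field k] [Ring A] [Algebra k A]

theorem face_zero {n : ℕ} (a : Fin (n + 2) → A) :
    face 0 a = Fin.cons (a 0 * a 1) (Fin.tail (Fin.tail a)) := by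
  funext l
  refine Fin.cases ?_ (fun l => ?_) l
  · simp [face, Fin.ext_iff]
  · simp [face, Fin.ext_iff, Fin.tail]

theorem face_succ {n : ℕ} (j : Fin (n + 1)) (a : Fin (n + 3) → A) :
    face j.succ.castSucc a = Fin.cons (a 0) (face j.castSucc (Fin.tail a)) := by
  have h1 : j.succ.castSucc ≠ Fin.last (n + 2) := (Fin.castSucc_lt_last _).ne
  have h2 : j.castSucc ≠ Fin.last (n + 1) := (Fin.castSucc_lt_last _).ne
  funext l
  refine Fin.cases ?_ (fun l => ?_) l
  · simp [face]
  · simp only [face, if_neg h1, if_neg h2, Fin.cons_succ, Fin.val_succ, Fin.val_castSucc,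
      add_lt_add_iff_right, add_left_inj, Fin.tail, Fin.succ_castSucc]

theorem face_last {n : ℕ} (a : Fin (n + 2) → A) :
    face (Fin.last (n + 1)) a
      = Fin.cons (a (Fin.last (n + 1)) * a 0) (Fin.tail (Fin.init a)) := by
  funext l
  refine Fin.cases ?_ (fun l => ?_) l
  · simp [face]
  · simp [face, Fin.tail, Fin.init]

theorem formWord_cons {n : ℕ} (x : A) (a : Fin n → A) :
    formWord k (Fin.cons x a : Fin (n + 1) → A) = zeroForm k x * exactWord k a := by
  simp [formWord]

theorem exactWord_cons {n : ℕ} (x : A) (a : Fin n → A) :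
    exactWord k (Fin.cons x a : Fin (n + 1) → A) = exactForm k x * exactWord k a := by
  simp [exactWord_succ]

theorem formWord_last {n : ℕ} (a : Fin (n + 2) → A) :
    formWord k a = formWord k (Fin.init a) * exactForm k (a (Fin.last (n + 1))) := by
  rw [formWord, exactWord_last, formWord, mul_assoc]
  rfl

/-- Moving a zero-form from the left to the right of a product of exact one-forms by the Leibniz
rule. -/
theorem exactWord_faces {n : ℕ} (a : Fin (n + 2) → A) :
    zeroForm k (a 0) * exactWord k (Fin.tail a)
        - ∑ j : Fin (n + 1), (-1 : k) ^ (j : ℕ) • exactWord k (face j.castSucc a)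
      = (-1 : k) ^ (n + 1) • (exactWord k (Fin.init a) * zeroForm k (a (Fin.last (n + 1)))) := by
  induction n with
  | zero =>
    simp only [Fin.sum_univ_succ, Finset.univ_eq_empty, Finset.sum_empty, exactWord_succ,
      exactWord_zero]
    simp only [mul_one, Fin.val_zero, pow_zero, one_smul, add_zero, zero_add, pow_one, neg_smul]
    change zeroForm k (a 0) * exactForm k (a 1) - exactForm k (a 0 * a 1)
      = -(exactForm k (a 0) * zeroForm k (a 1))
    rw [exactForm_mul]
    abel
  | succ n ih =>
    have h := ih (Fin.tail a)
    rw [Fin.sum_univ_succ, Fin.castSucc_zero, face_zero, exactWord_cons]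
    simp only [face_succ, exactWord_cons, Fin.val_succ, Fin.val_zero, pow_zero, one_smul]
    rw [exactWord_succ (Fin.init a), exactWord_succ (Fin.tail a), exactForm_mul]
    have h1 : Fin.tail (Fin.init a) = Fin.init (Fin.tail a) := rfl
    have h2 : Fin.tail a (Fin.last (n + 1)) = a (Fin.last (n + 2)) := rfl
    have h3 : Fin.init a 0 = a 0 := rfl
    have h4 : Fin.tail a 0 = a 1 := rfl
    rw [h2, h4] at h
    rw [h1, h3, h4, mul_assoc, pow_succ, mul_neg_one, neg_smul, ← mul_smul_comm, ← h, mul_sub,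
      Finset.mul_sum]
    simp only [pow_succ, mul_neg_one, neg_smul, Finset.sum_neg_distrib, mul_smul_comm]
    noncomm_ring

/-- All faces but the last add up to `± a₀ d a₁ ⋯ d aₙ aₙ₊₁`. -/
theorem formWord_faces {n : ℕ} (a : Fin (n + 2) → A) :
    ∑ j : Fin (n + 1), (-1 : k) ^ (j : ℕ) • formWord k (face j.castSucc a)
      = (-1 : k) ^ n • (formWord k (Fin.init a) * zeroForm k (a (Fin.last (n + 1)))) := by
  cases n with
  | zero =>
    simp only [Fin.sum_univ_succ, Finset.univ_eq_empty, Finset.sum_empty, formWord,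
      exactWord_zero]
    simp only [mul_one, Fin.val_zero, pow_zero, one_smul, add_zero]
    exact zeroForm_mul k (a 0) (a 1)
  | succ n =>
    have h := exactWord_faces (k := k) (Fin.tail a)
    have h2 : Fin.tail a (Fin.last (n + 1)) = a (Fin.last (n + 2)) := rfl
    have h3 : Fin.init a 0 = a 0 := rfl
    have h4 : Fin.tail a 0 = a 1 := rfl
    rw [h2, h4] at h
    rw [Fin.sum_univ_succ, Fin.castSucc_zero, face_zero, formWord_cons]
    simp only [face_succ, formWord_cons, Fin.val_succ, Fin.val_zero, pow_zero, one_smul]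
    rw [formWord, h3, mul_assoc, ← mul_smul_comm]
    change _ = zeroForm k (a 0) * ((-1 : k) ^ (n + 1) • (exactWord k (Fin.init (Fin.tail a)) * _))
    rw [← h, mul_sub, Finset.mul_sum, zeroForm_mul, mul_assoc]
    simp only [pow_succ, mul_neg_one, neg_smul, Finset.sum_neg_distrib, mul_smul_comm]
    rw [sub_eq_add_neg]

theorem reducedHochschildB_chainWord {n : ℕ} (a : Fin (n + 2) → A) :
    reducedHochschildB k A n (chainWord k a)
      = ∑ j : Fin (n + 2), (-1 : k) ^ (j : ℕ) • chainWord k (face j a) := by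
  change toReducedChains k A n (hochschildB k A n _) = _
  rw [hochschildB_tprod, map_sum]
  simp only [map_smul]
  rfl

theorem reducedConnesB_chainWord {n : ℕ} (a : Fin (n + 1) → A) :
    reducedConnesB k A n (chainWord k a)
      = ∑ i : Fin (n + 1), (-1 : k) ^ (n * (i : ℕ)) • chainWord k (rotated i a) := by
  change toReducedChains k A (n + 1) (connesB k A n _) = _
  rw [connesB_tprod, map_sum]
  simp only [map_smul]
  rfl

/-- The Hochschild differential is `b (ω d a) = (-1)^|ω| [ω, a]`. -/
theorem reducedHochschildB_formClass {n : ℕ} {w : Omega k A} (hw : w ∈ formsOfDegree k A n)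
    (a : A) : reducedHochschildB k A n (formClass k A (n + 1) (w * exactForm k a))
      = (-1 : k) ^ n • formClass k A n (w * zeroForm k a - zeroForm k a * w) := by
  rw [formsOfDegree_eq_span] at hw
  induction hw using Submodule.span_induction with
  | mem w h =>
    obtain ⟨x, rfl⟩ := h
    have hx : formWord k x * exactForm k a = formWord k (Fin.snoc x a : Fin (n + 2) → A) := by
      rw [formWord_last]
      simp
    rw [hx, formClass_formWord, reducedHochschildB_chainWord]
    simp only [← formClass_formWord, ← map_smul, ← map_sum]
    rw [Fin.sum_univ_castSucc]
    simp only [Fin.val_castSucc]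
    rw [formWord_faces, face_last, formWord_cons, zeroForm_mul]
    simp only [Fin.init_snoc, Fin.snoc_last, Fin.val_last]
    have h0 : (Fin.snoc x a : Fin (n + 2) → A) 0 = x 0 := by
      simp
    rw [h0, mul_assoc, pow_succ, mul_neg_one, neg_smul, smul_sub, sub_eq_add_neg]
    rfl
  | zero => simp
  | add x y _ _ hx hy =>
    rw [add_mul, map_add, map_add, hx, hy, ← smul_add, ← map_add]
    congr 2
    noncomm_ring
  | smul c x _ hx =>
    rw [smul_mul_assoc, map_smul, map_smul, hx, smul_comm, ← map_smul, smul_sub, smul_mul_assoc,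
      mul_smul_comm]

variable (k A) in
/-- The de Rham differential, transported to reduced chains. -/
def chainDeRham (n : ℕ) : ReducedChains k A n →ₗ[k] ReducedChains k A (n + 1) :=
  (formsEquivChains k A (n + 1)).toLinearMap ∘ₗ reducedDeRham k A n ∘ₗ
    (formsEquivChains k A n).symm.toLinearMap

variable (k A) in
/-- The reduced contraction with `Δ`, transported to reduced chains. -/
def chainContraction (n : ℕ) : ReducedChains k A (n + 1) →ₗ[k] ReducedChains k A n :=
  (formsEquivChains k A n).toLinearMap ∘ₗ reducedContractionBar (Delta k A) n ∘ₗ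
    (formsEquivChains k A (n + 1)).symm.toLinearMap

theorem chainDeRham_formClass {n : ℕ} {w : Omega k A} (hw : w ∈ formsOfDegree k A n) :
    chainDeRham k A n (formClass k A n w) = formClass k A (n + 1) (deRham k A w) := by
  rw [← formsEquivChains_apply ⟨w, hw⟩]
  simp only [chainDeRham, LinearMap.comp_apply, LinearEquiv.coe_coe, LinearEquiv.symm_apply_apply]
  rfl

theorem chainContraction_formClass {n : ℕ} {w : Omega k A} (hw : w ∈ formsOfDegree k A (n + 1)) :
    chainContraction k A n (formClass k A (n + 1) w)
      = formClass k A n (reducedContraction (Delta k A) w) := by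
  rw [← formsEquivChains_apply ⟨w, hw⟩]
  simp only [chainContraction, LinearMap.comp_apply, LinearEquiv.coe_coe,
    LinearEquiv.symm_apply_apply]
  rfl

theorem exactForm_mem (a : A) : exactForm k a ∈ formsOfDegree k A 1 :=
  exact_pow_le 1 (by rw [pow_one]; exact ⟨a, rfl⟩)

theorem mul_mem_degree {p q n : ℕ} (hn : n = p + q) {x y : Omega k A}
    (hx : x ∈ formsOfDegree k A p) (hy : y ∈ formsOfDegree k A q) :
    x * y ∈ formsOfDegree k A n :=
  hn ▸ formsOfDegree_mul_le p q (Submodule.mul_mem_mul hx hy)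

variable (k A) in
/-- The Karoubi operator on reduced chains. -/
abbrev chainKaroubi (n : ℕ) : Module.End k (ReducedChains k A n) :=
  karoubi (chainDeRham k A) (reducedHochschildB k A) n

/-- The Karoubi operator is `κ (ω d a) = (-1)^|ω| (d a) ω`. -/
theorem karoubi_formClass {n : ℕ} {w : Omega k A} (hw : w ∈ formsOfDegree k A n) (a : A) :
    chainKaroubi k A (n + 1) (formClass k A (n + 1) (w * exactForm k a))
      = (-1 : k) ^ n • formClass k A (n + 1) (exactForm k a * w) := by
  have hd : deRham k A (w * exactForm k a) = deRham k A w * exactForm k a := by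
    rw [deRham_mul, deRham_exactForm, mul_zero, add_zero]
  have hwa : w * zeroForm k a - zeroForm k a * w ∈ formsOfDegree k A n :=
    sub_mem (mul_mem_degree (add_zero n).symm hw (zeroForm_mem a))
      (mul_mem_degree (zero_add n).symm (zeroForm_mem a) hw)
  simp only [chainKaroubi, karoubi, laplacian, LinearMap.sub_apply, Module.End.one_apply,
    LinearMap.add_apply, LinearMap.comp_apply]
  rw [chainDeRham_formClass (mul_mem_degree rfl hw (exactForm_mem a)), hd,
    reducedHochschildB_formClass (deRham_mem hw), reducedHochschildB_formClass hw, map_smul,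
    chainDeRham_formClass hwa]
  simp only [← map_smul, ← map_add, ← map_sub]
  congr 1
  have hs : (-1 : k) ^ n * (-1) ^ n = 1 := by rw [← mul_pow]; simp
  rw [map_smul, map_sub, deRham_mul, deRham_mul, deRham_zeroForm, signAut_zeroForm,
    signAut_of_degree hw, smul_mul_assoc, pow_succ, mul_neg_one]
  simp only [smul_sub, smul_add, smul_smul, hs, neg_smul, one_smul]
  abel

/-- The `q`-th power of the Karoubi operator moves a product `η` of `q` exact one-forms around:
`κ^q (ω η) = ± η ω`. The exponent `q (n + 1)` has the parity of `q (n - 1)`. -/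
theorem karoubi_pow_formClass (q : ℕ) : ∀ {p n : ℕ} (_ : n = p + q) {w y : Omega k A}
    (_ : w ∈ formsOfDegree k A p) (_ : y ∈ LinearMap.range (exactForm k (A := A)) ^ q),
    (chainKaroubi k A n ^ q) (formClass k A n (w * y))
      = (-1 : k) ^ (q * (n + 1)) • formClass k A n (y * w) := by
  induction q with
  | zero =>
    intro p n hn w y hw hy
    obtain ⟨r, rfl⟩ := Submodule.mem_one.1 (by rwa [pow_zero] at hy)
    simp [Algebra.commutes]
  | succ q ih =>
    intro p n hn w y hw hy
    rw [pow_succ] at hy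
    obtain rfl : n = p + q + 1 := hn
    induction hy using Submodule.mul_induction_on' with
    | mem_mul_mem y hy _ ha =>
      obtain ⟨a, rfl⟩ := ha
      rw [pow_succ, Module.End.mul_apply, ← mul_assoc,
        karoubi_formClass (mul_mem_degree rfl hw (exact_pow_le q hy)), map_smul, ← mul_assoc,
        ih (p := p + 1) (by ring) (mul_mem_degree (add_comm p 1) (exactForm_mem a) hw) hy, smul_smul,
        ← pow_add, mul_assoc]
      congr 1
      apply neg_one_pow_congr
      simp only [Nat.even_add, Nat.even_mul, Nat.even_add_one]
      tauto
    | add x _ y _ hx hy => simp only [mul_add, add_mul, map_add, hx, hy, smul_add]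

theorem chainDeRham_zeroForm_mul {n : ℕ} (a : A) {y : Omega k A}
    (hy : y ∈ LinearMap.range (exactForm k (A := A)) ^ n) :
    chainDeRham k A n (formClass k A n (zeroForm k a * y))
      = formClass k A (n + 1) (exactForm k a * y) := by
  rw [chainDeRham_formClass (Submodule.mul_mem_mul ⟨a, rfl⟩ hy), deRham_mul, deRham_zeroForm,
    deRham_exact_pow n hy, mul_zero, add_zero]

theorem exact_mul_mem {n : ℕ} (a : A) {y : Omega k A}
    (hy : y ∈ LinearMap.range (exactForm k (A := A)) ^ n) :
    exactForm k a * y ∈ LinearMap.range (exactForm k (A := A)) ^ (n + 1) := by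
  rw [pow_succ']
  exact Submodule.mul_mem_mul ⟨a, rfl⟩ hy

theorem one_mem_degree : (1 : Omega k A) ∈ formsOfDegree k A 0 := by
  rw [← zeroForm_one]
  exact zeroForm_mem 1

theorem chainDeRham_chainDeRham (n : ℕ) (x : ReducedChains k A n) :
    chainDeRham k A (n + 1) (chainDeRham k A n x) = 0 := by
  refine LinearMap.congr_fun (f := chainDeRham k A (n + 1) ∘ₗ chainDeRham k A n) (g := 0)
    (reducedChains_ext fun a y hy => ?_) x
  have h := exact_mul_mem a hy
  rw [LinearMap.comp_apply, chainDeRham_zeroForm_mul a hy, chainDeRham_formClass (exact_pow_le _ h),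
    deRham_exact_pow _ h, map_zero]
  rfl

theorem reducedHochschildB_reducedHochschildB (n : ℕ) (x : ReducedChains k A (n + 2)) :
    reducedHochschildB k A n (reducedHochschildB k A (n + 1) x) = 0 := by
  refine LinearMap.congr_fun (f := reducedHochschildB k A n ∘ₗ reducedHochschildB k A (n + 1))
    (g := 0) (LinearMap.ext_on_range (chainWord_span (n + 2)) fun a => ?_) x
  rw [LinearMap.comp_apply, ← formClass_formWord, formWord_last,
    reducedHochschildB_formClass (formWord_mem _), formWord_last, map_smul]
  have hw := formWord_mem (k := k) (Fin.init (Fin.init a))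
  generalize formWord k (Fin.init (Fin.init a)) = w at hw
  generalize Fin.init a (Fin.last (n + 1)) = u
  generalize a (Fin.last (n + 1 + 1)) = v
  -- `ω d u v = ω d (u v) - ω u d v`
  have h1 : w * exactForm k u * zeroForm k v - zeroForm k v * (w * exactForm k u)
      = w * exactForm k (u * v) - w * zeroForm k u * exactForm k v
        - zeroForm k v * w * exactForm k u := by
    rw [exactForm_mul]
    noncomm_ring
  rw [h1, map_sub, map_sub, map_sub, map_sub, reducedHochschildB_formClass hw,
    reducedHochschildB_formClass (mul_mem_degree (add_zero n).symm hw (zeroForm_mem u)),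
    reducedHochschildB_formClass (mul_mem_degree (zero_add n).symm (zeroForm_mem v) hw),
    ← smul_sub, ← smul_sub, ← map_sub, ← map_sub, zeroForm_mul]
  have h2 : w * (zeroForm k u * zeroForm k v) - zeroForm k u * zeroForm k v * w
      - (w * zeroForm k u * zeroForm k v - zeroForm k v * (w * zeroForm k u))
      - (zeroForm k v * w * zeroForm k u - zeroForm k u * (zeroForm k v * w)) = 0 := by
    noncomm_ring
  rw [h2]
  simp

theorem karoubi_pow_chainDeRham (n : ℕ) (x : ReducedChains k A n) :
    (chainKaroubi k A (n + 1) ^ (n + 1)) (chainDeRham k A n x) = chainDeRham k A n x := by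
  refine LinearMap.congr_fun (f := (chainKaroubi k A (n + 1) ^ (n + 1)) ∘ₗ chainDeRham k A n)
    (reducedChains_ext fun a y hy => ?_) x
  rw [LinearMap.comp_apply, chainDeRham_zeroForm_mul a hy]
  have h := karoubi_pow_formClass (n + 1) (zero_add _).symm one_mem_degree (exact_mul_mem a hy)
  rw [one_mul, mul_one, (Nat.even_mul_succ_self (n + 1)).neg_one_pow, one_smul] at h
  exact h

theorem karoubi_pow_eq (n : ℕ) (x : ReducedChains k A n) :
    (chainKaroubi k A n ^ n) x = x + reducedHochschildB k A n
      ((chainKaroubi k A (n + 1) ^ n) (chainDeRham k A n x)) := by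
  refine LinearMap.congr_fun (f := chainKaroubi k A n ^ n) (g := LinearMap.id +
    reducedHochschildB k A n ∘ₗ (chainKaroubi k A (n + 1) ^ n) ∘ₗ chainDeRham k A n)
    (reducedChains_ext fun a y hy => ?_) x
  have hs : (-1 : k) ^ (n * (n + 1 + 1)) * (-1) ^ n = 1 := by
    rw [← pow_add]
    exact Even.neg_one_pow (by simp [Nat.even_add, Nat.even_mul, Nat.even_add_one])
  simp only [LinearMap.add_apply, LinearMap.comp_apply, LinearMap.id_apply]
  rw [chainDeRham_zeroForm_mul a hy, karoubi_pow_formClass n (zero_add n).symm (zeroForm_mem a) hy,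
    karoubi_pow_formClass n (add_comm n 1) (exactForm_mem a) hy, map_smul,
    reducedHochschildB_formClass (exact_pow_le n hy), smul_smul, hs, one_smul,
    (Nat.even_mul_succ_self n).neg_one_pow, one_smul, map_sub]
  abel

/-- The part of `ı_Δ (ω η)` that comes from the contraction of `η = d a₁ ⋯ d a_q` is
`-b (1 + κ + ⋯ + κ^(q-1)) (ω η)`: the term of `d aⱼ` is the commutator
`± [aⱼ, d aⱼ₊₁ ⋯ ω ⋯ d aⱼ₋₁]`, which is `b` of a cyclic rotation of `ω η`. -/
theorem signedSwapMul_contraction [CharZero k] (q : ℕ) : ∀ {p n : ℕ} (_ : n + 1 = p + q)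
    {w y : Omega k A} (_ : w ∈ formsOfDegree k A p)
    (_ : y ∈ LinearMap.range (exactForm k (A := A)) ^ q),
    formClass k A n (signedSwapMul k A ((signAut k A w ⊗ₜ[k] 1) * contraction (Delta k A) y))
      = -reducedHochschildB k A n ((∑ i ∈ Finset.range q, chainKaroubi k A (n + 1) ^ i)
          (formClass k A (n + 1) (w * y))) := by
  induction q with
  | zero =>
    intro p n hn w y hw hy
    rw [(contraction_exact_pow _ 0 hy).1 rfl]
    simp
  | succ q ih =>
    intro p n hn w y hw hy
    rw [pow_succ'] at hy
    obtain rfl : n = p + q := by omega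
    induction hy using Submodule.mul_induction_on' with
    | mem_mul_mem _ ha y hy =>
      obtain ⟨a, rfl⟩ := ha
      have hy' := exact_pow_le q hy
      have h1 : contraction (Delta k A) (exactForm k a)
          = 1 ⊗ₜ[k] zeroForm k a - zeroForm k a ⊗ₜ[k] 1 := by
        rw [contraction_exactForm]
        simp [Delta, tensorZeroForms_tmul, zeroForm_one]
      have h2 : (signAut k A w ⊗ₜ[k] (1 : Omega k A)) * contraction (Delta k A) (exactForm k a * y)
          = signAut k A w ⊗ₜ[k] (zeroForm k a * y) - (signAut k A w * zeroForm k a) ⊗ₜ[k] y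
            + (signAut k A (w * exactForm k a) ⊗ₜ[k] 1) * contraction (Delta k A) y := by
        rw [contraction_mul, h1, mul_add, sub_mul, mul_sub, ← mul_assoc, map_mul]
        simp only [Algebra.TensorProduct.tmul_mul_tmul, one_mul, mul_one]
        rw [← mul_assoc, Algebra.TensorProduct.tmul_mul_tmul, one_mul, signAut_exactForm]
      have h3 : signedSwapMul k A
          (signAut k A w ⊗ₜ[k] (zeroForm k a * y) - (signAut k A w * zeroForm k a) ⊗ₜ[k] y)
          = ((-1 : k) ^ p * (-1) ^ (p * q)) • (zeroForm k a * y * w - y * (w * zeroForm k a)) := by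
        rw [signAut_of_degree hw, smul_mul_assoc, ← TensorProduct.smul_tmul',
          ← TensorProduct.smul_tmul', ← smul_sub, map_smul, map_sub,
          signedSwapMul_tmul hw (mul_mem_degree (zero_add q).symm (zeroForm_mem a) hy'),
          signedSwapMul_tmul (mul_mem_degree (add_zero p).symm hw (zeroForm_mem a)) hy',
          ← smul_sub, smul_smul]
      have h4 : (chainKaroubi k A (p + q + 1) ^ q)
          (formClass k A (p + q + 1) (w * (exactForm k a * y)))
          = (-1 : k) ^ (q * (p + q + 2)) • formClass k A (p + q + 1) (y * w * exactForm k a) := by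
        rw [← mul_assoc, karoubi_pow_formClass q (p := p + 1) (by ring)
          (mul_mem_degree rfl hw (exactForm_mem a)) hy, mul_assoc]
      have h5 : (-1 : k) ^ p * (-1) ^ (p * q) = (-1) ^ (q * (p + q + 2)) * (-1) ^ (p + q) := by
        rw [← pow_add, ← pow_add]
        apply neg_one_pow_congr
        simp only [Nat.even_add, Nat.even_mul, Nat.even_add_one]
        tauto
      rw [h2, map_add, h3, map_add, ih (p := p + 1) (by ring)
        (mul_mem_degree rfl hw (exactForm_mem a)) hy, Finset.sum_range_succ, LinearMap.add_apply,
        map_add, h4, map_smul, map_smul,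
        reducedHochschildB_formClass (mul_mem_degree (add_comm p q) hy' hw), smul_smul, ← h5,
        mul_assoc w, neg_add, ← smul_neg, ← map_neg (formClass k A (p + q)), neg_sub,
        mul_assoc y, mul_assoc (zeroForm k a)]
      exact add_comm _ _
    | add x _ y _ hx hy => simp only [mul_add, map_add, hx, hy, neg_add]

theorem chainContraction_eq [CharZero k] (n : ℕ) (x : ReducedChains k A (n + 1)) :
    chainContraction k A n x = -reducedHochschildB k A n
      ((∑ i ∈ Finset.range (n + 1), chainKaroubi k A (n + 1) ^ i) x) := by
  refine LinearMap.congr_fun (g := -(reducedHochschildB k A n ∘ₗ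
    (∑ i ∈ Finset.range (n + 1), chainKaroubi k A (n + 1) ^ i)))
    (reducedChains_ext fun a y hy => ?_) x
  have h := signedSwapMul_contraction (n + 1) (zero_add (n + 1)).symm (zeroForm_mem a) hy
  rw [signAut_zeroForm] at h
  rw [chainContraction_formClass (Submodule.mul_mem_mul ⟨a, rfl⟩ hy), reducedContraction,
    LinearMap.comp_apply, contraction_mul, contraction_zeroForm, zero_mul, zero_add,
    signAut_zeroForm, h]
  rfl

theorem list_prod_mem {S : Submodule k (Omega k A)} {l : List (Omega k A)} (h : ∀ x ∈ l, x ∈ S) :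
    l.prod ∈ S ^ l.length := by
  induction l with
  | nil => exact Submodule.one_le.1 le_rfl
  | cons x l ih =>
    rw [List.prod_cons, List.length_cons, pow_succ']
    exact Submodule.mul_mem_mul (h x List.mem_cons_self)
      (ih fun y hy => h y (List.mem_cons_of_mem x hy))

/-- A word of Connes' operator is the cyclic rotation of `d a₀ ⋯ d aₙ` at the `i`-th place. -/
theorem formWord_rotated {n : ℕ} (i : Fin (n + 1)) (a : Fin (n + 1) → A) :
    formWord k (rotated i a)
      = ((List.ofFn fun j => exactForm k (a j)).drop i).prod
        * ((List.ofFn fun j => exactForm k (a j)).take i).prod := by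
  rw [rotated, formWord_cons, zeroForm_one, one_mul, exactWord, ← List.prod_append,
    ← List.rotate_eq_drop_append_take (by simp only [List.length_ofFn]; omega)]
  congr 1
  refine List.ext_getElem (by simp) fun j h1 h2 => ?_
  simp only [List.getElem_ofFn, List.getElem_rotate, List.length_ofFn]
  congr 2

theorem reducedConnesB_eq (n : ℕ) (x : ReducedChains k A n) :
    reducedConnesB k A n x = (∑ i ∈ Finset.range (n + 1), chainKaroubi k A (n + 1) ^ i)
      (chainDeRham k A n x) := by
  refine LinearMap.congr_fun (g := (∑ i ∈ Finset.range (n + 1), chainKaroubi k A (n + 1) ^ i) ∘ₗ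
    chainDeRham k A n) (LinearMap.ext_on_range (chainWord_span n) fun a => ?_) x
  set y := chainDeRham k A n (chainWord k a) with hy
  have hy' : y = formClass k A (n + 1) (exactWord k a) := by
    rw [hy, ← formClass_formWord, formWord, chainDeRham_zeroForm_mul _ (exactWord_mem _),
      exactWord_succ a]
  have hterm (i : Fin (n + 1)) : (-1 : k) ^ (n * (i : ℕ)) • chainWord k (rotated i a)
      = (chainKaroubi k A (n + 1) ^ (n + 1 - 1 - (i : ℕ) + 1)) y := by
    have hi := i.isLt
    set l := List.ofFn fun j => exactForm k (a j) with hl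
    have hmem : ∀ x ∈ l, x ∈ LinearMap.range (exactForm k (A := A)) := by
      intro x hx
      obtain ⟨j, rfl⟩ := (List.mem_ofFn' _ _).1 hx
      exact ⟨_, rfl⟩
    have ht := list_prod_mem (k := k) fun x hx => hmem x (List.mem_of_mem_take (i := (i : ℕ)) hx)
    have hd := list_prod_mem (k := k) fun x hx => hmem x (List.mem_of_mem_drop (i := (i : ℕ)) hx)
    have hlen : l.length = n + 1 := by simp [hl]
    rw [List.length_take, hlen, min_eq_left hi.le] at ht
    rw [List.length_drop, hlen] at hd
    have e : n + 1 - 1 - (i : ℕ) + 1 = n + 1 - i := by omega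
    obtain ⟨m, hm⟩ : ∃ m, n + 1 = i + m := ⟨n + 1 - i, by omega⟩
    have hm' : n + 1 - (i : ℕ) = m := by omega
    rw [hm'] at hd e
    have hprod : exactWord k a = (l.take i).prod * (l.drop i).prod := by
      rw [← List.prod_append, List.take_append_drop]
      rfl
    rw [hy', hprod, e, karoubi_pow_formClass m hm (exact_pow_le _ ht) hd, ← formWord_rotated,
      formClass_formWord]
    congr 1
    apply neg_one_pow_congr
    have := congrArg Even hm
    simp only [Nat.even_add, Nat.even_mul, Nat.even_add_one, eq_iff_iff] at this ⊢
    tauto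
  rw [reducedConnesB_chainWord, LinearMap.comp_apply, ← hy]
  simp only [hterm]
  rw [Fin.sum_univ_eq_sum_range
    (fun i => (chainKaroubi k A (n + 1) ^ (n + 1 - 1 - i + 1)) y) (n + 1),
    Finset.sum_range_reflect (fun i => (chainKaroubi k A (n + 1) ^ (i + 1)) y) (n + 1),
    LinearMap.sum_apply]
  have h1 := Finset.sum_range_succ (fun i => (chainKaroubi k A (n + 1) ^ i) y) (n + 1)
  rw [Finset.sum_range_succ', hy, karoubi_pow_chainDeRham, pow_zero, Module.End.one_apply] at h1
  exact add_right_cancel h1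

variable (k A) in
/-- The relations of Cuntz and Quillen on reduced chains, together with the description of the reduced
contraction. -/
theorem karoubiRelations [CharZero k] : KaroubiRelations (chainDeRham k A)
    (reducedHochschildB k A) (chainContraction k A) (reducedConnesB k A) where
  d_d := chainDeRham_chainDeRham
  b_b := reducedHochschildB_reducedHochschildB
  karoubi_pow_d := karoubi_pow_chainDeRham
  karoubi_pow := karoubi_pow_eq
  contraction := chainContraction_eq
  connes := reducedConnesB_eq

end Words

/-! ### The comparison of the two complexes -/

section Homology

/-- Maps between two spaces of cycles which preserve boundaries, and which are inverse to each other
up to boundaries, induce an isomorphism of homology. -/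
def homologyEquiv {k V V' : Type*} [Field k] [AddCommGroup V] [Module k V] [AddCommGroup V']
    [Module k V'] {Z B : Submodule k V} {Z' B' : Submodule k V'} (f : V →ₗ[k] V') (g : V' →ₗ[k] V)
    (hfZ : ∀ x ∈ Z, f x ∈ Z') (hfB : ∀ x ∈ B, f x ∈ B') (hgZ : ∀ x ∈ Z', g x ∈ Z)
    (hgB : ∀ x ∈ B', g x ∈ B) (hgf : ∀ x ∈ Z, g (f x) - x ∈ B)
    (hfg : ∀ x ∈ Z', f (g x) - x ∈ B') :
    (Z ⧸ B.submoduleOf Z) ≃ₗ[k] (Z' ⧸ B'.submoduleOf Z') :=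
  LinearEquiv.ofLinearMap (Submodule.mapQ _ _ (f.restrict hfZ) fun x hx => hfB x hx)
    (Submodule.mapQ _ _ (g.restrict hgZ) fun x hx => hgB x hx)
    (by
      refine Submodule.linearMap_qext _ (LinearMap.ext fun x => ?_)
      exact (Submodule.Quotient.eq _).2 (hfg x x.2))
    (by
      refine Submodule.linearMap_qext _ (LinearMap.ext fun x => ?_)
      exact (Submodule.Quotient.eq _).2 (hgf x x.2))

/-- Multiplication by `(-1)ᵐ` on the components in `M m`. -/
def signMap (k : Type*) [Field k] (M : ℕ → Type*) [∀ m, AddCommGroup (M m)]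
    [∀ m, Module k (M m)] : (ℤ → ∀ m, M m) →ₗ[k] (ℤ → ∀ m, M m) :=
  LinearMap.pi fun p => LinearMap.pi fun m =>
    (-1 : k) ^ m • (LinearMap.proj m ∘ₗ LinearMap.proj p)

section Sign

variable {k : Type*} [Field k] {M : ℕ → Type*} [∀ m, AddCommGroup (M m)] [∀ m, Module k (M m)]

theorem signMap_apply (x : ℤ → ∀ m, M m) (p : ℤ) (m : ℕ) :
    signMap k M x p m = (-1 : k) ^ m • x p m := rfl

theorem signMap_signMap (x : ℤ → ∀ m, M m) : signMap k M (signMap k M x) = x := by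
  funext p m
  rw [signMap_apply, signMap_apply, smul_smul, ← mul_pow]
  simp

theorem signMap_mem {n : ℤ} {x : ℤ → ∀ m, M m} (hx : x ∈ hatDegree k M n) :
    signMap k M x ∈ hatDegree k M n := fun p m h => by
  rw [signMap_apply, hx p m h, smul_zero]

theorem raise_zero (f : ∀ m, M m →ₗ[k] M (m + 1)) (x : ∀ m, M m) : raise f x 0 = 0 := rfl

theorem raise_succ (f : ∀ m, M m →ₗ[k] M (m + 1)) (x : ∀ m, M m) (m : ℕ) :
    raise f x (m + 1) = f m (x m) := rfl

theorem lower_apply (g : ∀ m, M (m + 1) →ₗ[k] M m) (x : ∀ m, M m) (m : ℕ) :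
    lower g x m = g m (x (m + 1)) := rfl

theorem raise_signMap (f : ∀ m, M m →ₗ[k] M (m + 1)) (x : ℤ → ∀ m, M m) (p : ℤ) (m : ℕ) :
    raise f (signMap k M x p) m = -((-1 : k) ^ m • raise f (x p) m) := by
  cases m with
  | zero => simp [raise_zero]
  | succ m => simp [raise_succ, signMap_apply, pow_succ]

theorem lower_signMap (g : ∀ m, M (m + 1) →ₗ[k] M m) (x : ℤ → ∀ m, M m) (p : ℤ) (m : ℕ) :
    lower g (signMap k M x p) m = -((-1 : k) ^ m • lower g (x p) m) := by
  simp [lower_apply, signMap_apply, pow_succ]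

variable (f : ∀ m, M m →ₗ[k] M (m + 1)) (g : ∀ m, M (m + 1) →ₗ[k] M m)

theorem hatDifferential_apply (x : ℤ → ∀ m, M m) (i : ℤ) (m : ℕ) :
    hatDifferential f g x i m = raise f (x i) m + lower g (x (i - 1)) m := rfl

theorem hatDifferential_signMap (x : ℤ → ∀ m, M m) :
    hatDifferential f g (signMap k M x) = -signMap k M (hatDifferential f g x) := by
  funext p m
  rw [Pi.neg_apply, Pi.neg_apply, signMap_apply, hatDifferential_apply, hatDifferential_apply,
    raise_signMap, lower_signMap, smul_add, neg_add]

end Sign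

variable (k : Type u) (A : Type v) [Field k] [Ring A] [Algebra k A]

theorem periodicDifferential_apply (x : ℤ → ∀ m, ReducedChains k A m) (p : ℤ) (m : ℕ) :
    periodicDifferential k A x p m = lower (reducedHochschildB k A) (x p) m
      + raise (reducedConnesB k A) (x (p + 1)) m := rfl

theorem periodicDifferential_signMap (x : ℤ → ∀ m, ReducedChains k A m) :
    periodicDifferential k A (signMap k _ x) = -signMap k _ (periodicDifferential k A x) := by
  funext p m
  rw [Pi.neg_apply, Pi.neg_apply, signMap_apply, periodicDifferential_apply,
    periodicDifferential_apply, raise_signMap, lower_signMap, smul_add, neg_add]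

theorem formsEquivChains_deRham (n : ℕ) (x : ReducedForms k A n) :
    formsEquivChains k A (n + 1) (reducedDeRham k A n x)
      = chainDeRham k A n (formsEquivChains k A n x) := by
  simp [chainDeRham]

theorem formsEquivChains_contraction (n : ℕ) (x : ReducedForms k A (n + 1)) :
    formsEquivChains k A n (reducedContractionBar (Delta k A) n x)
      = chainContraction k A n (formsEquivChains k A (n + 1) x) := by
  simp [chainContraction]

theorem reducedDeRham_symm (n : ℕ) (x : ReducedChains k A n) :
    reducedDeRham k A n ((formsEquivChains k A n).symm x)
      = (formsEquivChains k A (n + 1)).symm (chainDeRham k A n x) := by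
  simp [chainDeRham]

theorem reducedContractionBar_symm (n : ℕ) (x : ReducedChains k A (n + 1)) :
    reducedContractionBar (Delta k A) n ((formsEquivChains k A (n + 1)).symm x)
      = (formsEquivChains k A n).symm (chainContraction k A n x) := by
  simp [chainContraction]

/-- The rescaling factors `± m!`, which turn the harmonic parts `d`, `-m b` of `d`, `ı_Δ` into the
harmonic parts `(m + 1) d`, `b` of `B`, `b`, up to a sign depending on the degree. -/
def rescale : ℕ → k
  | 0 => 1
  | m + 1 => (-1) ^ m * ((m + 1 : ℕ) : k) * rescale m

variable [CharZero k]

theorem rescale_ne_zero (m : ℕ) : rescale k m ≠ 0 := by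
  induction m with
  | zero => exact one_ne_zero
  | succ m ih =>
    exact mul_ne_zero (mul_ne_zero (pow_ne_zero _ (neg_ne_zero.2 one_ne_zero))
      (Nat.cast_ne_zero.2 m.succ_ne_zero)) ih

/-- The harmonic projection on reduced chains. -/
abbrev chainHarmonic (m : ℕ) : Module.End k (ReducedChains k A m) :=
  (karoubiRelations k A).harmonic m

/-- The Green operator on reduced chains. -/
abbrev chainGreen (m : ℕ) : Module.End k (ReducedChains k A m) :=
  (karoubiRelations k A).green m

/-- The map from forms to chains, in degrees `n` and `-n`, which is zero off the harmonic part. -/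
def toPeriodic (n : ℤ) : (ℤ → ∀ m, ReducedForms k A m) →ₗ[k] (ℤ → ∀ m, ReducedChains k A m) :=
  LinearMap.pi fun p => LinearMap.pi fun m => rescale k m • (chainHarmonic k A m ∘ₗ
    (formsEquivChains k A m).toLinearMap ∘ₗ LinearMap.proj m ∘ₗ LinearMap.proj (p + n))

/-- The map from chains to forms, in degrees `-n` and `n`, which is zero off the harmonic part. -/
def ofPeriodic (n : ℤ) : (ℤ → ∀ m, ReducedChains k A m) →ₗ[k] (ℤ → ∀ m, ReducedForms k A m) :=
  LinearMap.pi fun i => LinearMap.pi fun m => (rescale k m)⁻¹ •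
    ((formsEquivChains k A m).symm.toLinearMap ∘ₗ chainHarmonic k A m ∘ₗ LinearMap.proj m ∘ₗ
      LinearMap.proj (i - n))

theorem toPeriodic_apply (n : ℤ) (x : ℤ → ∀ m, ReducedForms k A m) (p : ℤ) (m : ℕ) :
    toPeriodic k A n x p m
      = rescale k m • chainHarmonic k A m (formsEquivChains k A m (x (p + n) m)) := rfl

theorem ofPeriodic_apply (n : ℤ) (x : ℤ → ∀ m, ReducedChains k A m) (i : ℤ) (m : ℕ) :
    ofPeriodic k A n x i m
      = (rescale k m)⁻¹ • (formsEquivChains k A m).symm (chainHarmonic k A m (x (i - n) m)) := rfl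

theorem toPeriodic_mem {n : ℤ} {x : ℤ → ∀ m, ReducedForms k A m}
    (hx : x ∈ hatDegree k (ReducedForms k A) n) :
    toPeriodic k A n x ∈ hatDegree k (ReducedChains k A) (-n) := fun p m h => by
  rw [toPeriodic_apply, hx (p + n) m (by omega), map_zero, map_zero, smul_zero]

theorem ofPeriodic_mem {n : ℤ} {x : ℤ → ∀ m, ReducedChains k A m}
    (hx : x ∈ hatDegree k (ReducedChains k A) (-n)) :
    ofPeriodic k A n x ∈ hatDegree k (ReducedForms k A) n := fun i m h => by
  rw [ofPeriodic_apply, hx (i - n) m (by omega), map_zero, map_zero, smul_zero]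

/-- The differential `d + t ı_Δ`. -/
abbrev formsDifferential : (ℤ → ∀ m, ReducedForms k A m) →ₗ[k] (ℤ → ∀ m, ReducedForms k A m) :=
  hatDifferential (reducedDeRham k A) (reducedContractionBar (Delta k A))

/-- The comparison map commutes with the differentials up to the sign `-(-1)ᵐ` in form degree
`m`. This sign allows the rescaling to be independent of the power of `t`: factors for a strict
chain map would alternate in sign with that power. -/
theorem periodicDifferential_toPeriodic {n n' : ℤ} (hn : n' = n + 1)
    (x : ℤ → ∀ m, ReducedForms k A m) : periodicDifferential k A (toPeriodic k A n x)
      = -signMap k _ (toPeriodic k A n' (formsDifferential k A x)) := by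
  have h := karoubiRelations k A
  funext p m
  have e1 : p + n' = p + 1 + n := by omega
  have e2 : p + n' - 1 = p + n := by omega
  rw [Pi.neg_apply, Pi.neg_apply, signMap_apply, periodicDifferential_apply, toPeriodic_apply,
    hatDifferential_apply, lower_apply, lower_apply, e2, e1, toPeriodic_apply, map_add, map_add,
    formsEquivChains_contraction, h.harmonic_contraction, h.contraction_eq, smul_add, smul_add,
    neg_add_rev, map_smul]
  have hs (m : ℕ) : (-1 : k) ^ m * (-1) ^ m = 1 := by rw [← mul_pow]; simp
  congr 1
  · rw [rescale, smul_smul, smul_smul, ← neg_smul]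
    congr 1
    ring
  · cases m with
    | zero => simp [raise_zero]
    | succ m =>
      rw [raise_succ, raise_succ, toPeriodic_apply, formsEquivChains_deRham, h.harmonic_d, map_smul,
        h.connes_eq, h.harmonic_harmonic, rescale, smul_smul, smul_smul, ← neg_smul]
      congr 1
      rw [pow_succ]
      linear_combination (-(rescale k m * ((m + 1 : ℕ) : k))) * hs m

theorem formsDifferential_ofPeriodic {n n' : ℤ} (hn : n' = n + 1)
    (x : ℤ → ∀ m, ReducedChains k A m) : formsDifferential k A (ofPeriodic k A n x)
      = -signMap k _ (ofPeriodic k A n' (periodicDifferential k A x)) := by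
  have h := karoubiRelations k A
  have hs (m : ℕ) : (-1 : k) ^ m * (-1) ^ m = 1 := by rw [← mul_pow]; simp
  have hr (m : ℕ) : (rescale k m)⁻¹ = (-1) ^ m * ((m + 1 : ℕ) : k) * (rescale k (m + 1))⁻¹ := by
    have h1 := rescale_ne_zero k m
    have h2 := rescale_ne_zero k (m + 1)
    field_simp
    rw [rescale]
    ring
  funext i m
  have e1 : i - n' + 1 = i - n := by omega
  have e2 : i - 1 - n = i - n' := by omega
  rw [Pi.neg_apply, Pi.neg_apply, signMap_apply, hatDifferential_apply, ofPeriodic_apply,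
    periodicDifferential_apply, lower_apply, lower_apply, e1, ofPeriodic_apply, e2, map_add,
    h.harmonic_b, map_add, map_smul, reducedContractionBar_symm, h.contraction_eq,
    h.harmonic_harmonic, smul_add, smul_add, neg_add_rev, map_smul]
  congr 1
  · cases m with
    | zero => simp [raise_zero]
    | succ m =>
      rw [raise_succ, raise_succ, ofPeriodic_apply, h.harmonic_connes, map_smul,
        reducedDeRham_symm, h.connes_eq, map_smul, smul_smul, smul_smul, ← neg_smul, hr m]
      congr 1
      rw [pow_succ]
      ring
  · rw [smul_smul, smul_smul, ← neg_smul, hr m]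
    congr 1
    linear_combination (((m + 1 : ℕ) : k) * (rescale k (m + 1))⁻¹) * hs m

theorem ofPeriodic_toPeriodic (n : ℤ) (x : ℤ → ∀ m, ReducedForms k A m) (i : ℤ) (m : ℕ) :
    formsEquivChains k A m (ofPeriodic k A n (toPeriodic k A n x) i m)
      = chainHarmonic k A m (formsEquivChains k A m (x i m)) := by
  have h := karoubiRelations k A
  rw [ofPeriodic_apply, toPeriodic_apply, sub_add_cancel, map_smul, LinearEquiv.apply_symm_apply,
    map_smul, h.harmonic_harmonic, inv_smul_smul₀ (rescale_ne_zero k m)]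

theorem toPeriodic_ofPeriodic (n : ℤ) (x : ℤ → ∀ m, ReducedChains k A m) (p : ℤ) (m : ℕ) :
    toPeriodic k A n (ofPeriodic k A n x) p m = chainHarmonic k A m (x p m) := by
  have h := karoubiRelations k A
  rw [toPeriodic_apply, ofPeriodic_apply, add_sub_cancel_right, map_smul,
    LinearEquiv.apply_symm_apply, map_smul, h.harmonic_harmonic,
    smul_inv_smul₀ (rescale_ne_zero k m)]

/-- Off the harmonic part, `d + t ı_Δ` is `d`, which is contracted by `G b`. -/
theorem ofPeriodic_toPeriodic_sub_mem {n : ℤ} {x : ℤ → ∀ m, ReducedForms k A m}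
    (hx : x ∈ hatCocycles (reducedDeRham k A) (reducedContractionBar (Delta k A)) n) :
    ofPeriodic k A n (toPeriodic k A n x) - x
      ∈ hatCoboundaries (reducedDeRham k A) (reducedContractionBar (Delta k A)) n := by
  have h := karoubiRelations k A
  obtain ⟨hdeg, hx⟩ := hx
  refine ⟨fun i m => -(formsEquivChains k A m).symm (reducedHochschildB k A m
    (chainGreen k A (m + 1) (formsEquivChains k A (m + 1) (x i (m + 1))))), fun i m hm => ?_, ?_⟩
  · simp only
    rw [hdeg i (m + 1) (by push_cast; omega)]
    simp
  · funext i m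
    apply (formsEquivChains k A m).injective
    rw [Pi.sub_apply, Pi.sub_apply, map_sub, ofPeriodic_toPeriodic, chainHarmonic,
      h.harmonic_apply, sub_sub_cancel_left, hatDifferential_apply, lower_apply, map_add, map_neg,
      reducedContractionBar_symm, h.contraction_b, map_zero, neg_zero, map_zero, add_zero]
    -- the part `b d G` of the Laplacian vanishes on cocycles
    have hbd : reducedHochschildB k A m (chainDeRham k A m (chainGreen k A m
        (formsEquivChains k A m (x i m)))) = 0 := by
      have hc := congrArg (formsEquivChains k A (m + 1))
        (congrFun (congrFun (LinearMap.mem_ker.1 hx) i) (m + 1))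
      rw [hatDifferential_apply, raise_succ, lower_apply, map_add, formsEquivChains_deRham,
        formsEquivChains_contraction, Pi.zero_apply, Pi.zero_apply, map_zero] at hc
      rw [chainGreen, ← h.green_d, ← h.green_b, eq_neg_of_add_eq_zero_left hc, map_neg,
        h.b_contraction, neg_zero, map_zero]
    cases m with
    | zero =>
      rw [raise_zero, map_zero, eq_comm, neg_eq_zero]
      exact hbd
    | succ m =>
      rw [raise_succ, map_neg, map_neg, formsEquivChains_deRham, LinearEquiv.apply_symm_apply,
        laplacian, LinearMap.add_apply, LinearMap.comp_apply, LinearMap.comp_apply, hbd, zero_add]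

/-- Off the harmonic part, `b + B` is `b`, which is contracted by `G d`. -/
theorem toPeriodic_ofPeriodic_sub_mem {n : ℤ} {x : ℤ → ∀ m, ReducedChains k A m}
    (hx : x ∈ periodicCycles k A (-n)) :
    toPeriodic k A n (ofPeriodic k A n x) - x ∈ periodicBoundaries k A (-n) := by
  have h := karoubiRelations k A
  obtain ⟨hdeg, hx⟩ := hx
  refine ⟨fun p => raise (fun m => -(chainDeRham k A m ∘ₗ chainGreen k A m)) (x p),
    fun p m hm => ?_, ?_⟩
  · cases m with
    | zero => rfl
    | succ m =>
      simp only
      rw [raise_succ, hdeg p m (by push_cast at hm; omega), map_zero]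
  · funext p m
    rw [Pi.sub_apply, Pi.sub_apply, toPeriodic_ofPeriodic, chainHarmonic,
      h.harmonic_apply, sub_sub_cancel_left, periodicDifferential_apply, lower_apply, raise_succ]
    have hB : raise (reducedConnesB k A) (raise (fun m =>
        -(chainDeRham k A m ∘ₗ chainGreen k A m)) (x (p + 1))) m = 0 := by
      cases m with
      | zero => rfl
      | succ m =>
        cases m with
        | zero => rw [raise_succ, raise_zero, map_zero]
        | succ m =>
          rw [raise_succ, raise_succ, LinearMap.neg_apply, LinearMap.comp_apply, map_neg,
            h.connes_d, neg_zero]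
    rw [hB, add_zero, LinearMap.neg_apply, LinearMap.comp_apply, map_neg]
    cases m with
    | zero => rfl
    | succ m =>
      -- the part `d b G` of the Laplacian vanishes on cycles
      have hc : reducedHochschildB k A m (x p (m + 1))
          + raise (reducedConnesB k A) (x (p + 1)) m = 0 :=
        congrFun (congrFun (LinearMap.mem_ker.1 hx) p) m
      have hdB : chainDeRham k A m (raise (reducedConnesB k A) (x (p + 1)) m) = 0 := by
        cases m with
        | zero => rw [raise_zero, map_zero]
        | succ m => rw [raise_succ, h.d_connes]
      have hdb : chainDeRham k A m (reducedHochschildB k A m (chainGreen k A (m + 1)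
          (x p (m + 1)))) = 0 := by
        rw [chainGreen, ← h.green_b, ← h.green_d, eq_neg_of_add_eq_zero_left hc, map_neg, hdB,
          neg_zero, map_zero]
      rw [laplacian, LinearMap.add_apply, LinearMap.comp_apply, LinearMap.comp_apply, hdb, add_zero]

/-- The isomorphism between the homology of the forms and reduced periodic cyclic homology. -/
def formsHomologyEquiv (n : ℤ) : FormsHomology k A n ≃ₗ[k] ReducedHP k A (-n) :=
  homologyEquiv (toPeriodic k A n) (ofPeriodic k A n)
    (by
      rintro x ⟨hdeg, hx⟩
      refine ⟨toPeriodic_mem k A hdeg, LinearMap.mem_ker.2 ?_⟩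
      rw [periodicDifferential_toPeriodic k A rfl, LinearMap.mem_ker.1 hx]
      simp)
    (by
      rintro _ ⟨y, hdeg, rfl⟩
      refine ⟨signMap k _ (toPeriodic k A (n - 1) y), ?_, ?_⟩
      · have := signMap_mem (toPeriodic_mem k A hdeg)
        rwa [neg_sub, sub_eq_add_neg, add_comm] at this
      · rw [periodicDifferential_signMap,
          periodicDifferential_toPeriodic k A (sub_add_cancel n 1).symm, map_neg, neg_neg,
          signMap_signMap])
    (by
      rintro x ⟨hdeg, hx⟩
      refine ⟨ofPeriodic_mem k A hdeg, LinearMap.mem_ker.2 ?_⟩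
      rw [formsDifferential_ofPeriodic k A rfl, LinearMap.mem_ker.1 hx]
      simp)
    (by
      rintro _ ⟨y, hdeg, rfl⟩
      refine ⟨signMap k _ (ofPeriodic k A (n - 1) y), ?_, ?_⟩
      · refine signMap_mem (ofPeriodic_mem k A ?_)
        rwa [neg_sub, sub_eq_add_neg, add_comm]
      · rw [hatDifferential_signMap,
          formsDifferential_ofPeriodic k A (sub_add_cancel n 1).symm, map_neg, neg_neg,
          signMap_signMap])
    (fun _ hx => ofPeriodic_toPeriodic_sub_mem k A hx)
    (fun _ hx => toPeriodic_ofPeriodic_sub_mem k A hx)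

theorem formsHomologyEquiv_mulT (n : ℤ) (hn : -(n + 2) = -n - 2) (x : FormsHomology k A n) :
    formsHomologyEquiv k A (n + 2) (formsMulT k A n x)
      = periodicity k A (-n) (-(n + 2)) hn (formsHomologyEquiv k A n x) := by
  obtain ⟨x, rfl⟩ := Submodule.mkQ_surjective _ x
  refine congrArg Submodule.Quotient.mk (Subtype.ext (funext fun p => funext fun m => ?_))
  change toPeriodic k A (n + 2) (fun i => (x : ℤ → ∀ m, ReducedForms k A m) (i - 1)) p m
    = toPeriodic k A n x (p + 1) m
  rw [toPeriodic_apply, toPeriodic_apply]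
  have e : p + (n + 2) - 1 = p + 1 + n := by omega
  rw [e]

end Homology

end NCForms

end

/-- The homology of `(Ω̄ ⊗̂ k[t, t⁻¹], d + t ı_Δ)` is the reduced periodic cyclic homology of `A`
with inverted degrees, compatibly with multiplication by `t` and the periodicity maps. -/
theorem theorem4 {k : Type*} {A : Type*} [Field k] [CharZero k] [Ring A] [Algebra k A] :
    ∃ e : ∀ n : ℤ, NCForms.FormsHomology k A n ≃ₗ[k] NCForms.ReducedHP k A (-n),
      ∀ (n : ℤ) (x : NCForms.FormsHomology k A n),
        e (n + 2) (NCForms.formsMulT k A n x)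
          = NCForms.periodicity k A (-n) (-(n + 2)) (by omega) (e n x) := by
  exact ⟨NCForms.formsHomologyEquiv k A, fun n => NCForms.formsHomologyEquiv_mulT k A n _⟩
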